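/- Let $P\subset\mathbb{R}^3$ be a $3$-dimensional polytope that is perfectly centered: for every nonempty face $F$ of $P$ (including $F=P$), the relative interior of $F$ meets the outer normal cone $\mathcal N(F;P)=\{c\in\mathbb{R}^3 : F=S(P;c)\}$, where $S(P;c)$ is the set of maximizers of $\langle\cdot,c\rangle$ over $P$. For a set $Q$ write $Q^*=\{x : \langle x,y\rangle\le 1 \text{ for all } y\in Q\}$. A Nesterov rounding of $Q$ is a Minkowski sum $Q+\alpha Q^*$ with $\alpha>0$. Let $P_0=P$ and $P_{n+1}=P_n+\alpha_nP_n^*$ for $n\ge 0$, where $(\alpha_n)_{n\ge 0}$ is any sequence of positive reals (for instance $\alpha_n=1$ for all $n$). Then every $P_n$ is again a perfectly centered $3$-dimensional polytope, and, writing $f_k^{(n)}$ for the number of $k$-dimensional faces of $P_n$, for all $n\ge 1$ $$f_0^{(n)}=4^{n-1}f_0^{(1)},\qquad f_1^{(n)}=2\cdot 4^{n-1}f_0^{(1)},\qquad f_2^{(n)}=f_2^{(1)}+(4^{n-1}-1)f_0^{(1)}.$$ Consequently $f_2^{(n)}/f_0^{(n)}\to 1$ as $n\to\infty$. -/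

import Mathlib

open Filter Topology
open scoped Pointwise RealInnerProductSpace

namespace NesterovRounding

variable {E : Type*} [NormedAddCommGroup E] [InnerProductSpace ℝ E]

/-- A (convex) polytope: the convex hull of finitely many points. -/
def IsPolytope (P : Set E) : Prop :=
  ∃ s : Set E, s.Finite ∧ P = convexHull ℝ s

/-- The dimension of a set: the dimension of its affine span. It is only used for nonempty sets
(for the empty set it returns `0`). -/
noncomputable def dim (F : Set E) : ℕ :=
  Module.finrank ℝ (affineSpan ℝ F).direction

/-- The set `S(P; c)` of maximizers over `P` of the linear function `⟨·, c⟩`. -/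
def maximizers (P : Set E) (c : E) : Set E :=
  {x ∈ P | ∀ y ∈ P, ⟪y, c⟫ ≤ ⟪x, c⟫}

/-- A nonempty face of `P`: a nonempty set of the form `S(P; c)` (so `P` itself, with `c = 0`, is
a face). -/
def IsNonemptyFace (P F : Set E) : Prop :=
  F.Nonempty ∧ ∃ c : E, F = maximizers P c

/-- The outer normal cone `N(F; P)`: the set of vectors `c` with `F = S(P; c)`. -/
def normalCone (F P : Set E) : Set E :=
  {c | F = maximizers P c}

/-- `P` is perfectly centered: the relative interior of every nonempty face of `P` meets the
outer normal cone of `P` at that face. -/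
def IsPerfectlyCentered (P : Set E) : Prop :=
  ∀ F : Set E, IsNonemptyFace P F → (intrinsicInterior ℝ F ∩ normalCone F P).Nonempty

/-- The dual `P^*` (one-sided polar). -/
def dual (P : Set E) : Set E :=
  {x | ∀ y ∈ P, ⟪x, y⟫ ≤ 1}

/-- The Nesterov rounding `P + a P^*` of `P` with scaling factor `a`. -/
def rounding (a : ℝ) (P : Set E) : Set E :=
  P + a • dual P

/-- Repeated Nesterov rounding: `iterRounding α P n` is what `P` becomes after `n` roundings, the
`i`-th of which (counting from `0`) uses the scaling factor `α i`. -/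
def iterRounding (α : ℕ → ℝ) (P : Set E) : ℕ → Set E
  | 0 => P
  | n + 1 => rounding (α n) (iterRounding α P n)

/-- The set of `k`-dimensional faces of `P`. -/
def kFaces (k : ℕ) (P : Set E) : Set (Set E) :=
  {F | IsNonemptyFace P F ∧ dim F = k}

/-- The number `f_k(P)` of `k`-dimensional faces of `P`. For a polytope, `kFaces k P` is finite
(see `IsPolytope.finite_kFaces`), so this is the true cardinality. -/
noncomputable def faceNumber (k : ℕ) (P : Set E) : ℕ :=
  (kFaces k P).ncard

/-- The nonempty faces are the nonempty exposed subsets. -/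
theorem IsNonemptyFace.isExposed {P F : Set E} (h : IsNonemptyFace P F) : IsExposed ℝ P F := by
  obtain ⟨_, c, rfl⟩ := h
  intro _
  refine ⟨innerSL ℝ c, ?_⟩
  ext x
  simp [maximizers, real_inner_comm]

theorem IsPolytope.finite_kFaces {P : Set E} (hP : IsPolytope P) (k : ℕ) :
    (kFaces k P).Finite := by
  obtain ⟨s, hs, rfl⟩ := hP
  refine Set.Finite.of_finite_image (f := fun F : Set E => F.extremePoints ℝ)
    (hs.finite_subsets.subset ?_) ?_
  · rintro _ ⟨F, hF, rfl⟩
    exact (hF.1.isExposed.isExtreme.extremePoints_subset_extremePoints).trans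
      extremePoints_convexHull_subset
  · intro F hF G hG h
    have key : ∀ H ∈ kFaces k (convexHull ℝ s), closure (convexHull ℝ (H.extremePoints ℝ)) = H :=
      fun H hH => closure_convexHull_extremePoints
        (hH.1.isExposed.isCompact (hs.isCompact_convexHull (𝕜 := ℝ)))
        (hH.1.isExposed.convex (convex_convexHull ℝ s))
    rw [← key F hF, ← key G hG]
    exact congrArg (fun t => closure (convexHull ℝ t)) h

end NesterovRounding

namespace NesterovRounding

variable {E : Type*} [NormedAddCommGroup E] [InnerProductSpace ℝ E]

/-! A face of `P` is recorded by the set of defining inequalities that are tight on it (`actFace`),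
so inclusion of faces is reverse inclusion of active sets. Perfect centeredness gives every face a
center: a relative interior point `m` such that the face is the set of maximizers in direction `m`.
The decisive consequence is `maximizers_self_subset`: for every `x ∈ P`, the maximizers in direction
`x` lie in the smallest face containing `x`.

Let `c ≠ 0`, let `F` be the face of `P` maximizing `c`, and let `G` be the smallest face containing
the multiple of `c` on the boundary of `P`. The face of the dual maximizing `c` is the dual face
`G^D`, and the lemma says `F ⊆ G` (`exists_centers`). Thus every proper face of the rounding is `F +
a • G^D` for nested proper faces. Conversely, if `f` and `g` are centers of nested proper faces `F ⊆
G`, the vector `f + a • ⟪g, g⟫⁻¹ • g` cuts out `F + a • G^D` and is relatively interior to it. This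
gives both the bijection `bijOn_kFaces_rounding` and perfect centeredness of the rounding.

In dimension three, `F + a • G^D` has dimension `dim F + 2 - dim G`. So vertices of the rounding are
incident vertex-facet pairs, edges are incident vertex-edge and edge-facet pairs, and facets are the
pairs `F = G`. The diamond property and a double count of flags show that each of the three
incidence types has `2 f₁` pairs. Hence the new face numbers are `2 f₁`, `4 f₁` and `f₀ + f₁ + f₂`
(`faceNumber_rounding`). From the first rounding on, `f₁ = 2 f₀`, so each further rounding
multiplies `f₀` by 4 and adds `3 f₀` to `f₂`. -/

/-- `x` belongs to `S`, and every segment from a point of `S` to `x` can be prolonged beyond `x`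
within `S`. For convex sets in finite dimension this characterizes the relative interior. -/
def IsRelInner (S : Set E) (x : E) : Prop :=
  x ∈ S ∧ ∀ y ∈ S, ∃ ε : ℝ, 0 < ε ∧ x + ε • (x - y) ∈ S

/-! ### Relative interiors via prolongation of segments. -/

theorem mem_intrinsicInterior_iff_ball {S : Set E} {x : E} :
    x ∈ intrinsicInterior ℝ S ↔
      x ∈ S ∧ ∃ ε > 0, ∀ y ∈ affineSpan ℝ S, dist y x < ε → y ∈ S := by
  rw [mem_intrinsicInterior]
  constructor
  · rintro ⟨z, hz, rfl⟩
    rw [mem_interior_iff_mem_nhds, Metric.mem_nhds_iff] at hz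
    obtain ⟨ε, hε, h⟩ := hz
    refine ⟨h (Metric.mem_ball_self hε), ε, hε, fun y hy hd => ?_⟩
    exact h (show (⟨y, hy⟩ : affineSpan ℝ S) ∈ Metric.ball z ε from hd)
  · rintro ⟨hx, ε, hε, h⟩
    refine ⟨⟨x, subset_affineSpan ℝ S hx⟩, ?_, rfl⟩
    rw [mem_interior_iff_mem_nhds, Metric.mem_nhds_iff]
    exact ⟨ε, hε, fun y hy => h y y.2 hy⟩

theorem isRelInner_of_mem_intrinsicInterior {S : Set E} {x : E}
    (h : x ∈ intrinsicInterior ℝ S) : IsRelInner S x := by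
  obtain ⟨hx, r, hr, h⟩ := mem_intrinsicInterior_iff_ball.1 h
  refine ⟨hx, fun y hy => ⟨r / 2 / (‖x - y‖ + 1), by positivity, h _ ?_ ?_⟩⟩
  · have := AffineMap.lineMap_mem (1 + r / 2 / (‖x - y‖ + 1))
      (subset_affineSpan ℝ S hy) (subset_affineSpan ℝ S hx)
    convert this using 1
    rw [AffineMap.lineMap_apply_module']
    module
  · rw [dist_eq_norm, add_sub_cancel_left, norm_smul, Real.norm_of_nonneg (by positivity),
      div_mul_eq_mul_div, div_lt_iff₀ (by positivity)]
    nlinarith [norm_nonneg (x - y)]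

/-- Prolong a segment from a relative interior point `y` through `x` to a point `z ∈ S`. The
homothety with center `z` and ratio `ε / (1 + ε)` sends `y` to `x` and, by convexity, carries a
relative ball around `y` to one around `x` inside `S`. -/
theorem IsRelInner.mem_intrinsicInterior [FiniteDimensional ℝ E] {S : Set E} {x : E}
    (hS : Convex ℝ S) (h : IsRelInner S x) : x ∈ intrinsicInterior ℝ S := by
  obtain ⟨y, hy⟩ := Set.Nonempty.intrinsicInterior hS ⟨x, h.1⟩
  obtain ⟨hyS, r, hr, hball⟩ := mem_intrinsicInterior_iff_ball.1 hy
  obtain ⟨ε, hε, hz⟩ := h.2 y hyS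
  set z := x + ε • (x - y) with hzdef
  have h1 : (0 : ℝ) < 1 + ε := by positivity
  refine mem_intrinsicInterior_iff_ball.2 ⟨h.1, ε / (1 + ε) * r, by positivity, fun q hq hd => ?_⟩
  have hyq : z + ((1 + ε) / ε) • (q - z) ∈ S := by
    refine hball _ ?_ ?_
    · have := AffineMap.lineMap_mem ((1 + ε) / ε) (subset_affineSpan ℝ S hz) hq
      convert this using 1
      rw [AffineMap.lineMap_apply_module']
      module
    · have : z + ((1 + ε) / ε) • (q - z) - y = ((1 + ε) / ε) • (q - x) := by
        rw [hzdef]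
        match_scalars <;> field_simp <;> ring
      rw [dist_eq_norm, this, norm_smul, Real.norm_of_nonneg (by positivity)]
      rw [dist_eq_norm] at hd
      calc (1 + ε) / ε * ‖q - x‖ < (1 + ε) / ε * (ε / (1 + ε) * r) := by gcongr
        _ = r := by field_simp
  have := hS hz hyq (a := 1 / (1 + ε)) (b := ε / (1 + ε)) (by positivity) (by positivity)
    (by field_simp)
  convert this using 1
  match_scalars <;> field_simp <;> ring

theorem IsRelInner.add {S T : Set E} {x y : E} (hS : Convex ℝ S) (hT : Convex ℝ T)
    (hx : IsRelInner S x) (hy : IsRelInner T y) : IsRelInner (S + T) (x + y) := by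
  have shrink : ∀ {S : Set E} {x y : E} {ε δ : ℝ}, Convex ℝ S → x ∈ S → x + ε • (x - y) ∈ S →
      0 < δ → δ ≤ ε → x + δ • (x - y) ∈ S := by
    intro S x y ε δ hS hx h hδ hle
    have hε : 0 < ε := hδ.trans_le hle
    have := hS hx h (a := 1 - δ / ε) (b := δ / ε) (by rw [sub_nonneg, div_le_one hε]; exact hle)
      (by positivity) (by ring)
    convert this using 1
    match_scalars <;> field_simp
    ring
  refine ⟨Set.add_mem_add hx.1 hy.1, ?_⟩
  rintro _ ⟨a, ha, b, hb, rfl⟩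
  obtain ⟨ε, hε, h1⟩ := hx.2 a ha
  obtain ⟨δ, hδ, h2⟩ := hy.2 b hb
  have hm : 0 < min ε δ := lt_min hε hδ
  refine ⟨min ε δ, hm, x + min ε δ • (x - a), shrink hS hx.1 h1 hm (min_le_left _ _),
    y + min ε δ • (y - b), shrink hT hy.1 h2 hm (min_le_right _ _), ?_⟩
  simp only
  module

theorem IsRelInner.smul {S : Set E} {x : E} (hx : IsRelInner S x) (a : ℝ) :
    IsRelInner (a • S) (a • x) := by
  refine ⟨Set.smul_mem_smul_set hx.1, ?_⟩
  rintro _ ⟨y, hy, rfl⟩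
  obtain ⟨ε, hε, h⟩ := hx.2 y hy
  refine ⟨ε, hε, x + ε • (x - y), h, ?_⟩
  simp only
  module

/-! ### Maximizers -/

theorem maximizers_smul (P : Set E) (c : E) {t : ℝ} (ht : 0 < t) :
    maximizers P (t • c) = maximizers P c := by
  ext x
  simp only [maximizers, Set.mem_ofPred_eq, inner_smul_right, mul_le_mul_iff_right₀ ht]

theorem maximizers_zero (P : Set E) : maximizers P 0 = P := by
  ext x
  simp [maximizers]

theorem maximizers_subset (P : Set E) (c : E) : maximizers P c ⊆ P := fun _ h => h.1

/-- A common maximizer attains both maxima at once, so maximizing the sum forces equality in each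
summand. -/
theorem maximizers_add_right {P : Set E} {a b : E}
    (h : (maximizers P a ∩ maximizers P b).Nonempty) :
    maximizers P (a + b) = maximizers P a ∩ maximizers P b := by
  obtain ⟨z, hza, hzb⟩ := h
  ext x
  simp only [maximizers, Set.mem_ofPred_eq, Set.mem_inter_iff, inner_add_right]
  constructor
  · rintro ⟨hx, h⟩
    have h0 := h z hza.1
    have h1 := hza.2 x hx
    have h2 := hzb.2 x hx
    exact ⟨⟨hx, fun y hy => by linarith [hza.2 y hy]⟩, hx, fun y hy => by linarith [hzb.2 y hy]⟩
  · rintro ⟨⟨hx, h1⟩, _, h2⟩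
    exact ⟨hx, fun y hy => add_le_add (h1 y hy) (h2 y hy)⟩

theorem maximizers_add_left {P R : Set E} {c : E} :
    maximizers (P + R) c = maximizers P c + maximizers R c := by
  ext x
  constructor
  · rintro ⟨⟨p, hp, r, hr, rfl⟩, h⟩
    refine ⟨p, ⟨hp, fun y hy => ?_⟩, r, ⟨hr, fun y hy => ?_⟩, rfl⟩
    · have := h _ (Set.add_mem_add hy hr)
      simp only [inner_add_left] at this
      linarith
    · have := h _ (Set.add_mem_add hp hy)
      simp only [inner_add_left] at this
      linarith
  · rintro ⟨p, hp, r, hr, rfl⟩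
    refine ⟨Set.add_mem_add hp.1 hr.1, ?_⟩
    rintro _ ⟨p', hp', r', hr', rfl⟩
    simp only [inner_add_left]
    exact add_le_add (hp.2 _ hp') (hr.2 _ hr')

theorem maximizers_smul_left {P : Set E} {c : E} {t : ℝ} (ht : 0 < t) :
    maximizers (t • P) c = t • maximizers P c := by
  ext x
  constructor
  · rintro ⟨⟨p, hp, rfl⟩, h⟩
    refine ⟨p, ⟨hp, fun y hy => ?_⟩, rfl⟩
    have := h _ (Set.smul_mem_smul_set hy)
    simpa only [real_inner_smul_left, mul_le_mul_iff_right₀ ht] using this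
  · rintro ⟨p, hp, rfl⟩
    refine ⟨Set.smul_mem_smul_set hp.1, ?_⟩
    rintro _ ⟨p', hp', rfl⟩
    simpa only [real_inner_smul_left, mul_le_mul_iff_right₀ ht] using hp.2 _ hp'

theorem convex_maximizers {P : Set E} (hP : Convex ℝ P) (c : E) : Convex ℝ (maximizers P c) := by
  intro x hx y hy a b ha hb hab
  refine ⟨hP hx.1 hy.1 ha hb hab, fun z hz => ?_⟩
  rw [inner_add_left, real_inner_smul_left, real_inner_smul_left]
  have h1 := mul_le_mul_of_nonneg_left (hx.2 z hz) ha
  have h2 := mul_le_mul_of_nonneg_left (hy.2 z hz) hb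
  have : ⟪z, c⟫ = a * ⟪z, c⟫ + b * ⟪z, c⟫ := by rw [← add_mul, hab, one_mul]
  linarith

theorem maximizers_nonempty {P : Set E} (hP : IsCompact P) (hne : P.Nonempty) (c : E) :
    (maximizers P c).Nonempty := by
  obtain ⟨x, hx, h⟩ := hP.exists_isMaxOn hne
    (f := fun y => ⟪y, c⟫) (by fun_prop)
  exact ⟨x, hx, fun y hy => h hy⟩

theorem maximizers_eq_of_mem {P : Set E} {x c : E} (hx : x ∈ maximizers P c) :
    maximizers P c = {y ∈ P | ⟪y, c⟫ = ⟪x, c⟫} := by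
  ext y
  exact ⟨fun hy => ⟨hy.1, le_antisymm (hx.2 y hy.1) (hy.2 x hx.1)⟩,
    fun hy => ⟨hy.1, fun z hz => (hx.2 z hz).trans hy.2.ge⟩⟩

/-! ### Systems of inequalities and active constraints -/

/-- The solution set of the inequalities `⟪x, w⟫ ≤ 1`, `w ∈ W`. -/
def halfspaces (W : Set E) : Set E := {x | ∀ w ∈ W, ⟪x, w⟫ ≤ 1}

/-- The constraints in `W` that hold with equality at `x`. -/
def act (W : Set E) (x : E) : Set E := {w ∈ W | ⟪x, w⟫ = 1}

/-- The points of `halfspaces W` at which all constraints active at `x` are active. -/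
def actFace (W : Set E) (x : E) : Set E := {y ∈ halfspaces W | act W x ⊆ act W y}

theorem self_mem_actFace {W : Set E} {x : E} (hx : x ∈ halfspaces W) : x ∈ actFace W x :=
  ⟨hx, subset_rfl⟩

theorem convex_halfspaces (W : Set E) : Convex ℝ (halfspaces W) := by
  intro x hx y hy a b ha hb hab w hw
  rw [inner_add_left, real_inner_smul_left, real_inner_smul_left]
  nlinarith [hx w hw, hy w hw]

/-- Moving from `x` in a direction orthogonal to the active constraints. -/
theorem exists_forall_act_eq {W : Set E} (hW : W.Finite) {x : E} (hx : x ∈ halfspaces W) (d : E)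
    (hd : ∀ w ∈ act W x, ⟪d, w⟫ ≤ 0) :
    ∃ ε : ℝ, 0 < ε ∧ x + ε • d ∈ halfspaces W ∧
      act W (x + ε • d) = {w ∈ act W x | ⟪d, w⟫ = 0} := by
  -- Inactive constraints stay strict for small steps by continuity; finiteness of `W` yields one
  -- step that works for all of them.
  have key : ∀ w ∈ W, ∀ᶠ ε : ℝ in 𝓝[>] 0, w ∉ act W x → ⟪x + ε • d, w⟫ < 1 := by
    intro w hw
    by_cases hwx : w ∈ act W x
    · exact Eventually.of_forall fun _ h => absurd hwx h
    · have hlt : ⟪x, w⟫ < 1 := lt_of_le_of_ne (hx w hw) fun h => hwx ⟨hw, h⟩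
      have hc : Tendsto (fun ε : ℝ => ⟪x + ε • d, w⟫) (𝓝[>] 0) (𝓝 ⟪x, w⟫) := by
        have : Continuous fun ε : ℝ => ⟪x + ε • d, w⟫ := by fun_prop
        have h0 := this.tendsto 0
        simp only [zero_smul, add_zero] at h0
        exact h0.mono_left nhdsWithin_le_nhds
      filter_upwards [hc.eventually (gt_mem_nhds hlt)] with ε hε _ using hε
  obtain ⟨ε, hε, hpos⟩ := (((eventually_all_finite hW).2 key).and self_mem_nhdsWithin).exists
  have hpos : (0 : ℝ) < ε := hpos
  refine ⟨ε, hpos, fun w hw => ?_, ?_⟩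
  · by_cases hwx : w ∈ act W x
    · rw [inner_add_left, real_inner_smul_left, hwx.2]
      nlinarith [hd w hwx]
    · exact (hε w hw hwx).le
  · ext w
    constructor
    · rintro ⟨hw, h⟩
      have hwx : w ∈ act W x := by
        by_contra hwx
        exact (hε w hw hwx).ne h
      refine ⟨hwx, ?_⟩
      rw [inner_add_left, real_inner_smul_left, hwx.2, add_eq_left] at h
      exact (mul_eq_zero.1 h).resolve_left hpos.ne'
    · rintro ⟨hw, h⟩
      exact ⟨hw.1, by rw [inner_add_left, real_inner_smul_left, hw.2, h]; simp⟩

theorem isRelInner_actFace {W : Set E} (hW : W.Finite) {x : E} (hx : x ∈ halfspaces W) :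
    IsRelInner (actFace W x) x := by
  refine ⟨self_mem_actFace hx, fun y hy => ?_⟩
  have h0 : ∀ w ∈ act W x, ⟪x - y, w⟫ = 0 := fun w hw => by
    rw [inner_sub_left, hw.2, (hy.2 hw).2, sub_self]
  obtain ⟨ε, hε, h1, h2⟩ := exists_forall_act_eq hW hx (x - y) fun w hw => (h0 w hw).le
  refine ⟨ε, hε, h1, ?_⟩
  rw [h2]
  exact fun w hw => ⟨hw, h0 w hw⟩

/-- If all points of a set containing `x` in its relative interior satisfy an inequality that is
sharp at `x`, then it is sharp on the whole set. -/
theorem IsRelInner.inner_eq_one {S : Set E} {x c : E} (hx : IsRelInner S x)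
    (hle : ∀ y ∈ S, ⟪y, c⟫ ≤ 1) (h1 : ⟪x, c⟫ = 1) {y : E} (hy : y ∈ S) : ⟪y, c⟫ = 1 := by
  obtain ⟨ε, hε, h⟩ := hx.2 y hy
  have := hle _ h
  rw [inner_add_left, real_inner_smul_left, inner_sub_left, h1] at this
  have hy1 := hle y hy
  nlinarith

/-! ### Pairs of mutually dual polytopes -/

/-- `P` and `D` are mutually dual polytopes, with `V` and `W` finite sets generating them. -/
structure DualPair (P D V W : Set E) : Prop where
  finV : V.Finite
  finW : W.Finite
  left_hull : P = convexHull ℝ V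
  right_hull : D = convexHull ℝ W
  left_eq : P = halfspaces W
  right_eq : D = halfspaces V

theorem dual_convexHull (V : Set E) : dual (convexHull ℝ V) = halfspaces V := by
  ext x
  refine ⟨fun h v hv => h v (subset_convexHull ℝ V hv), fun h y hy => ?_⟩
  have hc : Convex ℝ {y : E | ⟪x, y⟫ ≤ 1} :=
    convex_halfSpace_le (innerSL ℝ x).toLinearMap.isLinear 1
  exact convexHull_min (fun v hv => h v hv) hc hy

theorem halfspaces_mem_nhds {W : Set E} (hW : W.Finite) : halfspaces W ∈ 𝓝 (0 : E) := by
  have : ∀ᶠ x : E in 𝓝 0, ∀ w ∈ W, ⟪x, w⟫ ≤ 1 := by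
    refine (eventually_all_finite hW).2 fun w _ => ?_
    have hc : Continuous fun x : E => ⟪x, w⟫ := by fun_prop
    have h0 := hc.tendsto 0
    rw [inner_zero_left] at h0
    filter_upwards [h0.eventually (gt_mem_nhds one_pos)] with x hx using hx.le
  exact this

theorem isClosed_halfspaces (W : Set E) : IsClosed (halfspaces W) := by
  have : halfspaces W = ⋂ w ∈ W, {x : E | ⟪x, w⟫ ≤ 1} := by
    ext x; simp [halfspaces]
  rw [this]
  exact isClosed_biInter fun w _ => isClosed_le (by fun_prop) continuous_const

/-- A bounded solution set of finitely many inequalities is a polytope. -/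
theorem exists_finite_halfspaces_eq_convexHull [FiniteDimensional ℝ E] {V : Set E}
    (hV : V.Finite) (hb : Bornology.IsBounded (halfspaces V)) :
    ∃ W : Set E, W.Finite ∧ halfspaces V = convexHull ℝ W := by
  have hcomp : IsCompact (halfspaces V) := Metric.isCompact_of_isClosed_isBounded
    (isClosed_halfspaces V) hb
  -- An extreme point is determined by its active constraints: if `y` has the same ones, the segment
  -- from `y` to `x` can be prolonged beyond `x`, which extremality forbids unless `y = x`.
  have hfin : ((halfspaces V).extremePoints ℝ).Finite := by
    refine Set.Finite.of_finite_image (f := act V)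
      (hV.finite_subsets.subset ?_) fun x hx y hy hxy => ?_
    · rintro _ ⟨x, _, rfl⟩
      exact fun w hw => hw.1
    · obtain ⟨ε, hε, hz⟩ := (isRelInner_actFace hV hx.1).2 y ⟨hy.1, hxy.le⟩
      refine (hx.2 hy.1 hz.1 ⟨ε / (1 + ε), 1 / (1 + ε), by positivity, by positivity,
        by field_simp; ring, ?_⟩).symm
      match_scalars <;> field_simp
      ring
  refine ⟨_, hfin, ?_⟩
  rw [← (hfin.isClosed_convexHull ℝ).closure_eq,
    closure_convexHull_extremePoints hcomp (convex_halfspaces V)]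

/-- A ball of radius `r` inside `P` confines the dual to the ball of radius `1 / r`, so the dual is
a polytope. Separating a point from `P` by a hyperplane gives the bipolar identity, that is, the
description of `P` by the generators of its dual. -/
theorem exists_dualPair [FiniteDimensional ℝ E] {P : Set E} (hP : IsPolytope P)
    (h0 : P ∈ 𝓝 (0 : E)) : ∃ V W, DualPair P (dual P) V W := by
  obtain ⟨V, hV, rfl⟩ := hP
  have hb : Bornology.IsBounded (halfspaces V) := by
    obtain ⟨r, hr, hball⟩ := Metric.nhds_basis_closedBall.mem_iff.1 h0
    refine (Metric.isBounded_closedBall (x := (0 : E)) (r := 1 / r)).subset fun x hx => ?_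
    rw [mem_closedBall_zero_iff]
    by_cases hx0 : x = 0
    · rw [hx0, norm_zero]; positivity
    rw [← dual_convexHull] at hx
    have hn : 0 < ‖x‖ := norm_pos_iff.2 hx0
    have := hx ((r / ‖x‖) • x) (hball (by
      rw [mem_closedBall_zero_iff, norm_smul, Real.norm_of_nonneg (by positivity)]
      field_simp
      exact le_rfl))
    rw [inner_smul_right, real_inner_self_eq_norm_sq] at this
    rw [le_div_iff₀ hr]
    calc ‖x‖ * r = r / ‖x‖ * ‖x‖ ^ 2 := by field_simp
      _ ≤ 1 := this
  obtain ⟨W, hW, hWD⟩ := exists_finite_halfspaces_eq_convexHull hV hb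
  rw [dual_convexHull]
  refine ⟨V, W, hV, hW, rfl, hWD, Set.Subset.antisymm (fun y hy w hw => ?_) fun y hy => ?_, rfl⟩
  · have hwD : w ∈ dual (convexHull ℝ V) := by
      rw [dual_convexHull, hWD]; exact subset_convexHull ℝ W hw
    rw [real_inner_comm]
    exact hwD y hy
  · by_contra hyP
    obtain ⟨f, u, hfu, huf⟩ := geometric_hahn_banach_closed_point (convex_convexHull ℝ V)
      (hV.isClosed_convexHull ℝ) hyP
    have hu : 0 < u := by simpa using hfu 0 (mem_of_mem_nhds h0)
    set c := (InnerProductSpace.toDual ℝ E).symm f with hc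
    have hcf : ∀ z, ⟪c, z⟫ = f z := fun z => InnerProductSpace.toDual_symm_apply
    have hcD : u⁻¹ • c ∈ convexHull ℝ W := by
      rw [← hWD, ← dual_convexHull]
      intro z hz
      rw [real_inner_smul_left, hcf, inv_mul_le_one₀ hu]
      exact (hfu z hz).le
    rw [← dual_convexHull] at hy
    have := hy _ hcD
    rw [inner_smul_right, real_inner_comm, hcf, inv_mul_le_one₀ hu] at this
    exact this.not_gt huf

namespace DualPair

variable {P D V W : Set E}

theorem symm (h : DualPair P D V W) : DualPair D P W V :=
  ⟨h.finW, h.finV, h.right_hull, h.left_hull, h.right_eq, h.left_eq⟩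

theorem right_eq_dual (h : DualPair P D V W) : D = dual P := by
  rw [h.right_eq, h.left_hull, dual_convexHull]

theorem inner_le (h : DualPair P D V W) {x y : E} (hx : x ∈ P) (hy : y ∈ D) : ⟪x, y⟫ ≤ 1 := by
  rw [real_inner_comm]
  rw [h.right_eq_dual] at hy
  exact hy x hx

theorem subset_right (h : DualPair P D V W) : W ⊆ D := by
  rw [h.right_hull]; exact subset_convexHull ℝ W

theorem isCompact (h : DualPair P D V W) : IsCompact P := by
  rw [h.left_hull]; exact h.finV.isCompact_convexHull ℝ

theorem convex (h : DualPair P D V W) : Convex ℝ P := by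
  rw [h.left_hull]; exact convex_convexHull ℝ V

theorem mem_nhds (h : DualPair P D V W) : P ∈ 𝓝 (0 : E) := by
  rw [h.left_eq]; exact halfspaces_mem_nhds h.finW

theorem zero_mem (h : DualPair P D V W) : (0 : E) ∈ P := mem_of_mem_nhds h.mem_nhds

theorem exists_smul_mem (h : DualPair P D V W) (c : E) : ∃ ε : ℝ, 0 < ε ∧ ε • c ∈ P := by
  have hc : Tendsto (fun ε : ℝ => ε • c) (𝓝[>] 0) (𝓝 0) := by
    have : Continuous fun ε : ℝ => ε • c := by fun_prop
    have h0 := this.tendsto 0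
    rw [zero_smul] at h0
    exact h0.mono_left nhdsWithin_le_nhds
  obtain ⟨ε, h1, h2⟩ := ((hc.eventually h.mem_nhds).and self_mem_nhdsWithin).exists
  exact ⟨ε, h2, h1⟩

/-- Boundedness of `P` in terms of its inequalities: otherwise the whole ray along `u` would lie in
`P`, against the inequality given by a small multiple of `u` in `D`. -/
theorem exists_inner_pos (h : DualPair P D V W) {u : E} (hu : u ≠ 0) : ∃ w ∈ W, 0 < ⟪u, w⟫ := by
  by_contra! hneg
  obtain ⟨ε, hε, hD⟩ := h.symm.exists_smul_mem u
  have hn : 0 < ⟪u, u⟫ := real_inner_self_pos.2 hu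
  have hP : (2 / (ε * ⟪u, u⟫)) • u ∈ P := by
    rw [h.left_eq]
    intro w hw
    rw [real_inner_smul_left]
    have : 0 ≤ 2 / (ε * ⟪u, u⟫) := by positivity
    nlinarith [hneg w hw]
  have := h.inner_le hP hD
  rw [real_inner_smul_left, inner_smul_right] at this
  have h2 : 2 / (ε * ⟪u, u⟫) * (ε * ⟪u, u⟫) = 2 := by field_simp
  linarith

/-- A nonzero vector can be scaled to a point of `D` that is tight on the maximizers. -/
theorem exists_tight (h : DualPair P D V W) {c : E} (hc : c ≠ 0) :
    ∃ t : ℝ, 0 < t ∧ t • c ∈ D ∧ maximizers P c = {y ∈ P | ⟪y, t • c⟫ = 1} := by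
  obtain ⟨x, hx⟩ := maximizers_nonempty h.isCompact ⟨0, h.zero_mem⟩ c
  have hpos : 0 < ⟪x, c⟫ := by
    obtain ⟨ε, hε, hP⟩ := h.exists_smul_mem c
    have := hx.2 _ hP
    rw [real_inner_smul_left] at this
    have hn : 0 < ⟪c, c⟫ := real_inner_self_pos.2 hc
    exact lt_of_lt_of_le (by positivity) this
  refine ⟨⟪x, c⟫⁻¹, inv_pos.2 hpos, ?_, ?_⟩
  · rw [h.right_eq_dual]
    intro y hy
    rw [real_inner_smul_left, inv_mul_le_one₀ hpos, real_inner_comm]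
    exact hx.2 y hy
  · rw [maximizers_eq_of_mem hx]
    ext y
    simp only [Set.mem_ofPred_eq, inner_smul_right, inv_mul_eq_one₀ hpos.ne']
    exact and_congr_right fun _ => eq_comm

theorem maximizers_eq_tight (h : DualPair P D V W) {c : E} (hc : c ∈ D) {x : E} (hx : x ∈ P)
    (h1 : ⟪x, c⟫ = 1) : maximizers P c = {y ∈ P | ⟪y, c⟫ = 1} := by
  rw [maximizers_eq_of_mem (x := x) ⟨hx, fun y hy => by rw [h1]; exact h.inner_le hy hc⟩, h1]

/-- The sum of the active constraints is the exposing functional: its maximum is attained exactly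
where every summand is tight. -/
theorem isNonemptyFace_actFace (h : DualPair P D V W) {x : E} (hx : x ∈ P) :
    IsNonemptyFace P (actFace W x) := by
  have hx' := hx
  rw [h.left_eq] at hx'
  refine ⟨⟨x, self_mem_actFace hx'⟩, ?_⟩
  have hfin : (act W x).Finite := h.finW.subset fun w hw => hw.1
  refine ⟨∑ w ∈ hfin.toFinset, w, ?_⟩
  have hle : ∀ y ∈ P, ∀ w ∈ hfin.toFinset, ⟪y, w⟫ ≤ ⟪x, w⟫ := fun y hy w hw => by
    rw [hfin.mem_toFinset] at hw
    rw [hw.2]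
    exact h.inner_le hy (h.subset_right hw.1)
  have hxm : x ∈ maximizers P (∑ w ∈ hfin.toFinset, w) := by
    refine ⟨hx, fun y hy => ?_⟩
    rw [inner_sum, inner_sum]
    exact Finset.sum_le_sum (hle y hy)
  rw [maximizers_eq_of_mem hxm]
  ext y
  constructor
  · rintro ⟨hy, hyx⟩
    refine ⟨by rw [h.left_eq]; exact hy, ?_⟩
    rw [inner_sum, inner_sum]
    refine Finset.sum_congr rfl fun w hw => ?_
    rw [hfin.mem_toFinset] at hw
    rw [hw.2, (hyx hw).2]
  · rintro ⟨hy, hs⟩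
    refine ⟨by rw [← h.left_eq]; exact hy, fun w hw => ?_⟩
    rw [inner_sum, inner_sum, Finset.sum_eq_sum_iff_of_le (hle y hy)] at hs
    exact ⟨hw.1, (hs w (hfin.mem_toFinset.2 hw)).trans hw.2⟩

/-- `IsRelInner.inner_eq_one` is used in both directions: on the maximizers with the constraints
active at `x`, and on `actFace W x` with `c` rescaled to be tight. The rescaling needs `c ≠ 0`. -/
theorem eq_actFace_of_isRelInner (h : DualPair P D V W) {c x : E}
    (hx : IsRelInner (maximizers P c) x) : maximizers P c = actFace W x := by
  have hxP : x ∈ P := hx.1.1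
  have hxW := hxP
  rw [h.left_eq] at hxW
  refine Set.Subset.antisymm (fun y hy => ⟨by rw [← h.left_eq]; exact hy.1, fun w hw => ?_⟩)
    fun y hy => ?_
  · exact ⟨hw.1, hx.inner_eq_one (fun z hz => h.inner_le hz.1 (h.subset_right hw.1)) hw.2 hy⟩
  · by_cases hc : c = 0
    · rw [hc, maximizers_zero, h.left_eq]
      exact hy.1
    obtain ⟨t, ht, htD, heq⟩ := h.exists_tight hc
    have h1 := hx.1
    rw [heq] at h1 ⊢
    refine ⟨by rw [h.left_eq]; exact hy.1, ?_⟩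
    refine (isRelInner_actFace h.finW hxW).inner_eq_one (fun z hz => ?_) h1.2 hy
    exact h.inner_le (by rw [h.left_eq]; exact hz.1) htD

theorem exists_eq_actFace [FiniteDimensional ℝ E] (h : DualPair P D V W) {F : Set E}
    (hF : IsNonemptyFace P F) : ∃ x ∈ P, F = actFace W x := by
  obtain ⟨hne, c, rfl⟩ := hF
  obtain ⟨x, hx⟩ := hne.intrinsicInterior (convex_maximizers h.convex c)
  have hr := isRelInner_of_mem_intrinsicInterior hx
  exact ⟨x, hr.1.1, h.eq_actFace_of_isRelInner hr⟩

end DualPair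

/-! ### Order and dimension of faces in terms of active constraints. -/

theorem actFace_subset_iff {W : Set E} {x y : E} (hx : x ∈ halfspaces W) :
    actFace W x ⊆ actFace W y ↔ act W y ⊆ act W x :=
  ⟨fun h => (h (self_mem_actFace hx)).2, fun h _ hz => ⟨hz.1, h.trans hz.2⟩⟩

theorem actFace_eq_iff {W : Set E} {x y : E} (hx : x ∈ halfspaces W) (hy : y ∈ halfspaces W) :
    actFace W x = actFace W y ↔ act W x = act W y := by
  rw [Set.Subset.antisymm_iff, actFace_subset_iff hx, actFace_subset_iff hy,
    Set.Subset.antisymm_iff, and_comm]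

theorem mem_orthogonal_span_iff {S : Set E} {d : E} :
    d ∈ (Submodule.span ℝ S)ᗮ ↔ ∀ w ∈ S, ⟪d, w⟫ = 0 := by
  constructor
  · intro hd w hw
    rw [real_inner_comm]; exact hd w (Submodule.subset_span hw)
  · intro hd w hw
    induction hw using Submodule.span_induction with
    | mem w hw => rw [real_inner_comm]; exact hd w hw
    | zero => exact inner_zero_left _
    | add a b _ _ ha hb => rw [inner_add_left, ha, hb, add_zero]
    | smul r a _ ha => rw [real_inner_smul_left, ha, mul_zero]

/-- A small step from `x` orthogonal to the active constraints remains in the face, so every such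
direction occurs. -/
theorem vectorSpan_actFace {W : Set E} (hW : W.Finite) {x : E} (hx : x ∈ halfspaces W) :
    vectorSpan ℝ (actFace W x) = (Submodule.span ℝ (act W x))ᗮ := by
  refine le_antisymm ?_ fun d hd => ?_
  · rw [vectorSpan_def, Submodule.span_le]
    rintro _ ⟨y, hy, z, hz, rfl⟩
    refine mem_orthogonal_span_iff.2 fun w hw => ?_
    simp only [vsub_eq_sub]
    rw [inner_sub_left, (hy.2 hw).2, (hz.2 hw).2, sub_self]
  · have h0 := mem_orthogonal_span_iff.1 hd
    obtain ⟨ε, hε, h1, h2⟩ := exists_forall_act_eq hW hx d fun w hw => (h0 w hw).le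
    have hm : x + ε • d ∈ actFace W x := ⟨h1, by rw [h2]; exact fun w hw => ⟨hw, h0 w hw⟩⟩
    have := vsub_mem_vectorSpan ℝ hm (self_mem_actFace hx)
    rw [vsub_eq_sub, add_sub_cancel_left] at this
    exact (Submodule.smul_mem_iff _ hε.ne').1 this

theorem dim_eq_finrank_vectorSpan (F : Set E) : dim F = Module.finrank ℝ (vectorSpan ℝ F) := by
  rw [dim, direction_affineSpan]

theorem mem_vectorSpan_actFace_iff {W : Set E} (hW : W.Finite) {x d : E}
    (hx : x ∈ halfspaces W) :
    d ∈ vectorSpan ℝ (actFace W x) ↔ ∀ w ∈ act W x, ⟪d, w⟫ = 0 := by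
  rw [vectorSpan_actFace hW hx, mem_orthogonal_span_iff]

/-- The dimension is strictly monotone on faces. -/
theorem dim_actFace_lt [FiniteDimensional ℝ E] {W : Set E} (hW : W.Finite) {x y : E}
    (hx : x ∈ halfspaces W) (hy : y ∈ halfspaces W) (h : act W y ⊂ act W x) :
    dim (actFace W x) < dim (actFace W y) := by
  rw [dim_eq_finrank_vectorSpan, dim_eq_finrank_vectorSpan]
  refine Submodule.finrank_lt_finrank_of_lt (lt_of_le_of_ne
    (vectorSpan_mono ℝ ((actFace_subset_iff hx).2 h.subset)) fun heq => h.not_subset fun w hw => ?_)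
  have hd : x - y ∈ vectorSpan ℝ (actFace W x) := by
    rw [heq, mem_vectorSpan_actFace_iff hW hy]
    intro w hw
    rw [inner_sub_left, hw.2, (h.subset hw).2, sub_self]
  have := (mem_vectorSpan_actFace_iff hW hx).1 hd w hw
  rw [inner_sub_left, hw.2] at this
  exact ⟨hw.1, by linarith⟩

/-! ### Moving along a line until a constraint becomes active -/

/-- Ratio test: the first constraint hit along the ray minimizes `(1 - ⟪p, w⟫) / ⟪u, w⟫` over the
constraints that increase along `u`. -/
theorem exists_exit {A : Set E} (hA : A.Finite) {p u : E} (hp : p ∈ halfspaces A)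
    (hu : ∀ w ∈ act A p, ⟪u, w⟫ = 0) (hpos : ∃ w ∈ A, 0 < ⟪u, w⟫) :
    ∃ t : ℝ, 0 < t ∧ p + t • u ∈ halfspaces A ∧ ∃ w ∈ act A (p + t • u), 0 < ⟪u, w⟫ := by
  have hfin : {w ∈ A | 0 < ⟪u, w⟫}.Finite := hA.subset fun w hw => hw.1
  obtain ⟨w₀, hw₀, hmin⟩ := Set.exists_min_image _ (fun w => (1 - ⟪p, w⟫) / ⟪u, w⟫) hfin hpos
  have hu0 : 0 < ⟪u, w₀⟫ := hw₀.2
  have hlt : ⟪p, w₀⟫ < 1 := lt_of_le_of_ne (hp _ hw₀.1) fun h =>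
    hu0.ne' (hu w₀ ⟨hw₀.1, h⟩)
  have ht : 0 < (1 - ⟪p, w₀⟫) / ⟪u, w₀⟫ := div_pos (by linarith) hu0
  refine ⟨_, ht, fun w hw => ?_, w₀, ⟨hw₀.1, ?_⟩, hu0⟩
  · rw [inner_add_left, real_inner_smul_left]
    by_cases hwu : 0 < ⟪u, w⟫
    · have := hmin w ⟨hw, hwu⟩
      rw [le_div_iff₀ hwu] at this
      linarith
    · nlinarith [hp w hw]
  · rw [inner_add_left, real_inner_smul_left]
    field_simp
    ring

theorem act_subset_act_add_smul {A : Set E} {p u : E} (hu : ∀ w ∈ act A p, ⟪u, w⟫ = 0) (t : ℝ) :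
    act A p ⊆ act A (p + t • u) := fun w hw =>
  ⟨hw.1, by rw [inner_add_left, real_inner_smul_left, hu w hw, hw.2]; ring⟩

theorem act_eq_of_lt_exit {A : Set E} {p u : E} (hp : p ∈ halfspaces A)
    (hu : ∀ w ∈ act A p, ⟪u, w⟫ = 0) {t s : ℝ} (hs : 0 < s) (hst : s < t)
    (ht : p + t • u ∈ halfspaces A) : act A (p + s • u) = act A p := by
  refine Set.Subset.antisymm (fun w hw => ⟨hw.1, ?_⟩) (act_subset_act_add_smul hu s)
  have h1 := hw.2
  have h2 := ht w hw.1
  have h3 := hp w hw.1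
  rw [inner_add_left, real_inner_smul_left] at h1 h2
  nlinarith

theorem act_line_cases {A : Set E} {p u : E} (hp : p ∈ halfspaces A)
    (hu : ∀ w ∈ act A p, ⟪u, w⟫ = 0) {t : ℝ} (ht : p + t • u ∈ halfspaces A)
    (hw : ∃ w ∈ act A (p + t • u), 0 < ⟪u, w⟫) {s : ℝ} (hs : 0 < s)
    (hsA : p + s • u ∈ halfspaces A) :
    act A (p + s • u) = act A p ∨ act A (p + s • u) = act A (p + t • u) := by
  rcases lt_trichotomy s t with hst | rfl | hst
  · exact Or.inl (act_eq_of_lt_exit hp hu hs hst ht)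
  · exact Or.inr rfl
  · exfalso
    obtain ⟨w, hw, hpos⟩ := hw
    have h1 := hw.2
    have h2 := hsA w hw.1
    rw [inner_add_left, real_inner_smul_left] at h1 h2
    nlinarith

/-- The sets of active constraints along a line that leaves the polyhedron in both directions. -/
theorem exists_two_exits {A : Set E} (hA : A.Finite) {p u : E} (hp : p ∈ halfspaces A)
    (hu : ∀ w ∈ act A p, ⟪u, w⟫ = 0) (hpos : ∃ w ∈ A, 0 < ⟪u, w⟫) (hneg : ∃ w ∈ A, ⟪u, w⟫ < 0) :
    ∃ t₁ t₂ : ℝ, p + t₁ • u ∈ halfspaces A ∧ p + t₂ • u ∈ halfspaces A ∧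
      act A p ⊂ act A (p + t₁ • u) ∧ act A p ⊂ act A (p + t₂ • u) ∧
      act A (p + t₁ • u) ≠ act A (p + t₂ • u) ∧
      ∀ s : ℝ, p + s • u ∈ halfspaces A → act A (p + s • u) = act A p ∨
        act A (p + s • u) = act A (p + t₁ • u) ∨ act A (p + s • u) = act A (p + t₂ • u) := by
  have hu' : ∀ w ∈ act A p, ⟪-u, w⟫ = 0 := fun w hw => by rw [inner_neg_left, hu w hw, neg_zero]
  have hsm : ∀ s : ℝ, p + s • -u = p + (-s) • u := fun s => by module
  obtain ⟨t₁, ht₁, hq₁, w₁, hw₁, hw₁u⟩ := exists_exit hA hp hu hpos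
  obtain ⟨t₂, ht₂, hq₂, w₂, hw₂, hw₂u⟩ := exists_exit hA hp hu' (by
    obtain ⟨w, hw, h⟩ := hneg
    exact ⟨w, hw, by rw [inner_neg_left]; linarith⟩)
  have c₁ := fun s => act_line_cases (s := s) hp hu hq₁ ⟨w₁, hw₁, hw₁u⟩
  have c₂ := fun s => act_line_cases (s := s) hp hu' hq₂ ⟨w₂, hw₂, hw₂u⟩
  rw [hsm] at hq₂ hw₂
  simp only [hsm] at c₂
  rw [inner_neg_left] at hw₂u
  refine ⟨t₁, -t₂, hq₁, hq₂, ⟨act_subset_act_add_smul hu _, fun h => hw₁u.ne' (hu _ (h hw₁))⟩,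
    ⟨act_subset_act_add_smul hu _, fun h => ?_⟩, fun h => ?_, fun s hs => ?_⟩
  · have := hu _ (h hw₂)
    linarith
  · rw [h] at hw₁
    have h1 := hw₁.2
    have h2 := hp _ hw₁.1
    rw [inner_add_left, real_inner_smul_left] at h1
    nlinarith
  · rcases lt_trichotomy s 0 with h | rfl | h
    · have := c₂ (-s) (by linarith)
      rw [neg_neg] at this
      rcases this hs with h | h
      · exact Or.inl h
      · exact Or.inr (Or.inr h)
    · left; simp
    · rcases c₁ s h hs with h | h
      · exact Or.inl h
      · exact Or.inr (Or.inl h)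

/-! ### The diamond property -/

/-- Along a ray from `x`, some point realizes exactly the active constraints of a point of the
cone at `x`. -/
theorem exists_act_eq_act_act {W : Set E} (hW : W.Finite) {x q : E} (hx : x ∈ halfspaces W)
    (hq : q ∈ halfspaces (act W x)) : ∃ z ∈ halfspaces W, act W z = act (act W x) q := by
  obtain ⟨ε, _, h1, h2⟩ := exists_forall_act_eq hW hx (q - x) fun w hw => by
    rw [inner_sub_left, hw.2]
    linarith [hq w hw]
  refine ⟨_, h1, ?_⟩
  rw [h2]
  ext w
  refine and_congr_right fun hw => ?_
  rw [inner_sub_left, hw.2, sub_eq_zero]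

/-- Between two faces whose dimensions differ by two there are exactly two faces. -/
theorem exists_diamond [FiniteDimensional ℝ E] {W : Set E} (hW : W.Finite) {f g : E}
    (hf : f ∈ halfspaces W) (hg : g ∈ halfspaces W) (hfg : act W g ⊆ act W f)
    (hdim : dim (actFace W g) = dim (actFace W f) + 2) :
    ∃ z₁ ∈ halfspaces W, ∃ z₂ ∈ halfspaces W, act W z₁ ≠ act W z₂ ∧
      (act W g ⊂ act W z₁ ∧ act W z₁ ⊂ act W f) ∧ (act W g ⊂ act W z₂ ∧ act W z₂ ⊂ act W f) ∧
      ∀ z ∈ halfspaces W, act W g ⊂ act W z → act W z ⊂ act W f →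
        act W z = act W z₁ ∨ act W z = act W z₂ := by
  rw [dim_eq_finrank_vectorSpan, dim_eq_finrank_vectorSpan] at hdim
  have hLf := fun d => mem_vectorSpan_actFace_iff (d := d) hW hf
  have hLg := fun d => mem_vectorSpan_actFace_iff (d := d) hW hg
  have hle : vectorSpan ℝ (actFace W f) ≤ vectorSpan ℝ (actFace W g) := fun d hd =>
    (hLg d).2 fun w hw => (hLf d).1 hd w (hfg hw)
  set Lf := vectorSpan ℝ (actFace W f)
  set Lg := vectorSpan ℝ (actFace W g)
  have hfin : (act W f).Finite := hW.subset fun w hw => hw.1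
  -- This functional vanishes on the directions of the smaller face and is negative on `y - f` for
  -- every point `y` of the polyhedron outside that face. Its level set through `g` therefore slices
  -- the cone at `f`.
  set c := ∑ w ∈ hfin.toFinset, w with hcdef
  have hc : ∀ d, ⟪d, c⟫ = ∑ w ∈ hfin.toFinset, ⟪d, w⟫ := fun d => inner_sum _ _ _
  have hcLf : ∀ d ∈ Lf, ⟪d, c⟫ = 0 := fun d hd => by
    rw [hc]
    exact Finset.sum_eq_zero fun w hw => (hLf d).1 hd w (hfin.mem_toFinset.1 hw)
  have hterm : ∀ y ∈ halfspaces W, ∀ w ∈ hfin.toFinset, ⟪y - f, w⟫ ≤ 0 := fun y hy w hw => by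
    rw [hfin.mem_toFinset] at hw
    rw [inner_sub_left, hw.2]
    linarith [hy w hw.1]
  have hneg : ∀ y ∈ halfspaces W, ¬ act W f ⊆ act W y → ⟪y - f, c⟫ < 0 := fun y hy hny => by
    rw [hc]
    refine lt_of_le_of_ne (Finset.sum_nonpos (hterm y hy)) fun h0 => hny fun w hw => ?_
    have := (Finset.sum_eq_zero_iff_of_nonpos (hterm y hy)).1 h0 w (hfin.mem_toFinset.2 hw)
    rw [inner_sub_left, hw.2] at this
    exact ⟨hw.1, by linarith⟩
  have hgf : ¬ act W f ⊆ act W g := fun h => by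
    have : Lg ≤ Lf := fun d hd => (hLf d).2 fun w hw => (hLg d).1 hd w (h hw)
    have := Submodule.finrank_mono this
    omega
  have hgfc := hneg g hg hgf
  have hgfL : g - f ∈ Lg := (hLg _).2 fun w hw => by
    rw [inner_sub_left, hw.2, (hfg hw).2, sub_self]
  have hgfLf : g - f ∉ Lf := fun h => hgfc.ne (hcLf _ h)
  have hr1 := Submodule.finrank_sup_span_singleton hgfLf
  obtain ⟨u₀, hu₀, hu₀n⟩ : ∃ u₀ ∈ Lg, u₀ ∉ Lf ⊔ Submodule.span ℝ {g - f} := by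
    by_contra! hcon
    have := Submodule.finrank_mono (show Lg ≤ Lf ⊔ Submodule.span ℝ {g - f} from hcon)
    omega
  have hr2 := Submodule.finrank_sup_span_singleton hu₀n
  have hLgeq : Lf ⊔ Submodule.span ℝ {g - f} ⊔ Submodule.span ℝ {u₀} = Lg := by
    refine Submodule.eq_of_le_of_finrank_eq (sup_le (sup_le hle ?_) ?_) (by omega)
    · rwa [Submodule.span_singleton_le_iff_mem]
    · rwa [Submodule.span_singleton_le_iff_mem]
  -- The correction makes `u` parallel to the slice. As the values of `u` on the constraints active
  -- at `f` sum to zero and do not all vanish, both signs occur, so the line `g + ℝ u` leaves the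
  -- cone in both directions. Its two exits are the two intermediate faces.
  set r := ⟪u₀, c⟫ / ⟪g - f, c⟫ with hr
  set u := u₀ - r • (g - f) with hudef
  have huc : ⟪u, c⟫ = 0 := by
    rw [hudef, inner_sub_left, real_inner_smul_left, hr, div_mul_cancel₀ _ hgfc.ne, sub_self]
  have huLg : u ∈ Lg := Lg.sub_mem hu₀ (Lg.smul_mem _ hgfL)
  have hunL : u ∉ Lf := fun hu => by
    refine hu₀n ?_
    have := Submodule.add_mem_sup hu
      (Submodule.smul_mem _ r (Submodule.mem_span_singleton_self (g - f)))
    rwa [hudef, sub_add_cancel] at this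
  have hsupp : ∃ w ∈ hfin.toFinset, ⟪u, w⟫ ≠ 0 := by
    by_contra! h0
    exact hunL ((hLf u).2 fun w hw => h0 w (hfin.mem_toFinset.2 hw))
  have hup : ∃ w ∈ act W f, 0 < ⟪u, w⟫ := by
    obtain ⟨w, hw, h⟩ := Finset.exists_pos_of_sum_zero_of_exists_nonzero _ ((hc u).symm.trans huc)
      hsupp
    exact ⟨w, hfin.mem_toFinset.1 hw, h⟩
  have hun : ∃ w ∈ act W f, ⟪u, w⟫ < 0 := by
    obtain ⟨w, hw, h⟩ := Finset.exists_pos_of_sum_zero_of_exists_nonzero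
      (s := hfin.toFinset) (fun w => -⟪u, w⟫)
      (by rw [Finset.sum_neg_distrib, ← hc, huc, neg_zero]) (by simpa using hsupp)
    exact ⟨w, hfin.mem_toFinset.1 hw, by linarith⟩
  have hgA : g ∈ halfspaces (act W f) := fun w hw => hg w hw.1
  have hactg : act (act W f) g = act W g :=
    Set.Subset.antisymm (fun w hw => ⟨hw.1.1, hw.2⟩) fun w hw => ⟨hfg hw, hw.2⟩
  obtain ⟨t₁, t₂, hq₁, hq₂, hs₁, hs₂, hne, hall⟩ := exists_two_exits hfin hgA
    (fun w hw => (hLg u).1 huLg w (by rwa [hactg] at hw)) hup hun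
  rw [hactg] at hs₁ hs₂ hall
  have hproper : ∀ t : ℝ, act (act W f) (g + t • u) ⊂ act W f := fun t => by
    refine ⟨fun w hw => hw.1, fun h => hgfc.ne ?_⟩
    have hm : g - f + t • u ∈ Lf := (hLf _).2 fun w hw => by
      have := (h hw).2
      rw [inner_add_left] at this ⊢
      rw [inner_sub_left, hw.2]
      linarith
    have := hcLf _ hm
    rwa [inner_add_left, real_inner_smul_left, huc, mul_zero, add_zero] at this
  obtain ⟨z₁, hz₁, ha₁⟩ := exists_act_eq_act_act hW hf hq₁
  obtain ⟨z₂, hz₂, ha₂⟩ := exists_act_eq_act_act hW hf hq₂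
  refine ⟨z₁, hz₁, z₂, hz₂, ?_⟩
  rw [ha₁, ha₂]
  refine ⟨hne, ⟨hs₁, hproper _⟩, ⟨hs₂, hproper _⟩, fun z hz hgz hzf => ?_⟩
  have hzL : z - f ∈ Lg := (hLg _).2 fun w hw => by
    rw [inner_sub_left, (hgz.subset hw).2, (hfg hw).2, sub_self]
  rw [← hLgeq, Submodule.mem_sup] at hzL
  obtain ⟨y, hy, v, hv, hyv⟩ := hzL
  obtain ⟨δ, hδ, a', ha', rfl⟩ := Submodule.mem_sup.1 hy
  obtain ⟨a, rfl⟩ := Submodule.mem_span_singleton.1 ha'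
  obtain ⟨b, rfl⟩ := Submodule.mem_span_singleton.1 hv
  set a₁ := a + b * r with ha₁def
  -- Any other intermediate point is projected onto the line: drop the component `δ` in `Lf` and
  -- divide by `a₁ > 0`. Neither operation changes which constraints of the cone are tight.
  have hdec : z - f = δ + a₁ • (g - f) + b • u := by
    rw [← hyv, hudef, ha₁def]; module
  have hzc := hneg z hz hzf.not_subset
  rw [hdec, inner_add_left, inner_add_left, real_inner_smul_left, real_inner_smul_left, huc,
    hcLf δ hδ, mul_zero, add_zero, zero_add] at hzc
  have hapos : 0 < a₁ := by nlinarith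
  have hval : ∀ w ∈ act W f, ⟪g + (b / a₁) • u, w⟫ - 1 = (⟪z, w⟫ - 1) / a₁ := fun w hw => by
    have h1 : ⟪z - f, w⟫ = ⟪z, w⟫ - 1 := by rw [inner_sub_left, hw.2]
    have h2 : ⟪g - f, w⟫ = ⟪g, w⟫ - 1 := by rw [inner_sub_left, hw.2]
    rw [← h1, hdec, inner_add_left, inner_add_left, inner_add_left, (hLf δ).1 hδ w hw,
      real_inner_smul_left, real_inner_smul_left, real_inner_smul_left, h2]
    field_simp
    ring
  have hmem : g + (b / a₁) • u ∈ halfspaces (act W f) := fun w hw => by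
    have h1 := hval w hw
    have h2 : (⟪z, w⟫ - 1) / a₁ ≤ 0 := div_nonpos_of_nonpos_of_nonneg
      (by linarith [hz w hw.1]) hapos.le
    linarith
  have hactz : act (act W f) (g + (b / a₁) • u) = act W z := by
    ext w
    constructor
    · rintro ⟨hw, h1⟩
      have h2 := hval w hw
      rw [h1, sub_self, eq_comm, div_eq_zero_iff, or_iff_left hapos.ne'] at h2
      exact ⟨hw.1, by linarith⟩
    · intro hw
      have h2 := hval w (hzf.subset hw)
      rw [hw.2, sub_self, zero_div] at h2
      exact ⟨hzf.subset hw, by linarith⟩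
  have := hall _ hmem
  rw [hactz] at this
  exact this.resolve_left hgz.ne'

namespace DualPair

variable {P D V W : Set E}

/-- A one-dimensional face has exactly two proper subfaces. -/
theorem exists_two_endpoints [FiniteDimensional ℝ E] (h : DualPair P D V W) {x : E}
    (hx : x ∈ halfspaces W) (hdim : dim (actFace W x) = 1) :
    ∃ z₁ ∈ halfspaces W, ∃ z₂ ∈ halfspaces W, act W z₁ ≠ act W z₂ ∧
      act W x ⊂ act W z₁ ∧ act W x ⊂ act W z₂ ∧
      ∀ z ∈ halfspaces W, act W x ⊂ act W z → act W z = act W z₁ ∨ act W z = act W z₂ := by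
  rw [dim_eq_finrank_vectorSpan] at hdim
  obtain ⟨u, hu, hall⟩ := finrank_eq_one_iff'.1 hdim
  have hu0 : (u : E) ≠ 0 := fun h => hu (Subtype.ext h)
  obtain ⟨t₁, t₂, h1, h2, hs1, hs2, hne, hcases⟩ := exists_two_exits h.finW hx
    ((mem_vectorSpan_actFace_iff h.finW hx).1 u.2) (h.exists_inner_pos hu0) (by
      obtain ⟨w, hw, hp⟩ := h.exists_inner_pos (neg_ne_zero.2 hu0)
      exact ⟨w, hw, by rw [inner_neg_left] at hp; linarith⟩)
  refine ⟨_, h1, _, h2, hne, hs1, hs2, fun z hz hxz => ?_⟩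
  have hd : z - x ∈ vectorSpan ℝ (actFace W x) :=
    vsub_mem_vectorSpan ℝ ⟨hz, hxz.subset⟩ (self_mem_actFace hx)
  obtain ⟨s, hs⟩ := hall ⟨_, hd⟩
  have hs' : s • (u : E) = z - x := congrArg Subtype.val hs
  have := hcases s
  rw [hs', add_sub_cancel] at this
  exact (this hz).resolve_left hxz.ne'

end DualPair

/-! ### Perfectly centered polytopes -/

/-- The points of `D` that are tight on all of `G`. -/
def dualFace (D G : Set E) : Set E := {y ∈ D | ∀ x ∈ G, ⟪x, y⟫ = 1}

/-- The center of the face `P` itself is interior, and an interior point `m` can maximize `⟪·, m⟫`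
only if `m = 0`. -/
theorem mem_nhds_zero_of_isPerfectlyCentered [FiniteDimensional ℝ E] {P : Set E}
    (hne : P.Nonempty) (hdim : dim P = Module.finrank ℝ E) (hpc : IsPerfectlyCentered P) :
    P ∈ 𝓝 (0 : E) := by
  have hspan : affineSpan ℝ P = ⊤ := by
    rw [← AffineSubspace.direction_eq_top_iff_of_nonempty
      ((affineSpan_nonempty (k := ℝ)).2 hne)]
    exact Submodule.eq_top_of_finrank_eq hdim
  obtain ⟨m, hm, hmP⟩ := hpc P ⟨hne, 0, (maximizers_zero P).symm⟩
  obtain ⟨hmem, r, hr, hball⟩ := mem_intrinsicInterior_iff_ball.1 hm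
  have hnhds : P ∈ 𝓝 m := Metric.mem_nhds_iff.2
    ⟨r, hr, fun y hy => hball y (by rw [hspan]; trivial) hy⟩
  have hm' : m ∈ maximizers P m := (show P = maximizers P m from hmP) ▸ hmem
  have hm0 : m = 0 := by
    by_contra hm0
    have hn : 0 < ⟪m, m⟫ := real_inner_self_pos.2 hm0
    have hc : Tendsto (fun ε : ℝ => m + ε • m) (𝓝[>] 0) (𝓝 m) := by
      have : Continuous fun ε : ℝ => m + ε • m := by fun_prop
      have h0 := this.tendsto 0
      rw [zero_smul, add_zero] at h0
      exact h0.mono_left nhdsWithin_le_nhds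
    obtain ⟨ε, h1, h2⟩ := ((hc.eventually hnhds).and self_mem_nhdsWithin).exists
    have h2 : 0 < ε := h2
    have := hm'.2 _ h1
    rw [inner_add_left, real_inner_smul_left] at this
    have := mul_pos h2 hn
    linarith
  rwa [hm0] at hnhds

theorem dim_eq_finrank_of_mem_nhds {P : Set E} {x : E} (h : P ∈ 𝓝 x) :
    dim P = Module.finrank ℝ E := by
  have hint : (interior (convexHull ℝ P)).Nonempty :=
    ⟨x, interior_mono (subset_convexHull ℝ P) (mem_interior_iff_mem_nhds.2 h)⟩
  rw [dim, affineSpan_eq_top_of_nonempty_interior hint, AffineSubspace.direction_top, finrank_top]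

/-! ### Directions of Minkowski sums, centers and dual faces. -/

theorem vectorSpan_add_set {A B : Set E} (hA : A.Nonempty) (hB : B.Nonempty) :
    vectorSpan ℝ (A + B) = vectorSpan ℝ A ⊔ vectorSpan ℝ B := by
  obtain ⟨a₀, ha₀⟩ := hA
  obtain ⟨b₀, hb₀⟩ := hB
  refine le_antisymm ?_ (sup_le ?_ ?_)
  · rw [vectorSpan_def, Submodule.span_le]
    rintro _ ⟨_, ⟨a, ha, b, hb, rfl⟩, _, ⟨a', ha', b', hb', rfl⟩, rfl⟩
    have := Submodule.add_mem_sup (vsub_mem_vectorSpan ℝ ha ha') (vsub_mem_vectorSpan ℝ hb hb')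
    simp only [vsub_eq_sub] at this ⊢
    rwa [add_sub_add_comm]
  · rw [vectorSpan_def, Submodule.span_le]
    rintro _ ⟨a, ha, a', ha', rfl⟩
    have := vsub_mem_vectorSpan ℝ (Set.add_mem_add ha hb₀) (Set.add_mem_add ha' hb₀)
    simp only [vsub_eq_sub] at this ⊢
    rwa [add_sub_add_right_eq_sub] at this
  · rw [vectorSpan_def, Submodule.span_le]
    rintro _ ⟨b, hb, b', hb', rfl⟩
    have := vsub_mem_vectorSpan ℝ (Set.add_mem_add ha₀ hb) (Set.add_mem_add ha₀ hb')
    simp only [vsub_eq_sub] at this ⊢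
    rwa [add_sub_add_left_eq_sub] at this

theorem vectorSpan_smul_set (A : Set E) {t : ℝ} (ht : t ≠ 0) :
    vectorSpan ℝ (t • A) = vectorSpan ℝ A := by
  have key : ∀ (s : ℝ) (B : Set E), vectorSpan ℝ (s • B) ≤ vectorSpan ℝ B := by
    intro s B
    rw [vectorSpan_def, Submodule.span_le]
    rintro _ ⟨_, ⟨a, ha, rfl⟩, _, ⟨b, hb, rfl⟩, rfl⟩
    have := Submodule.smul_mem _ s (vsub_mem_vectorSpan ℝ ha hb)
    simp only [vsub_eq_sub] at this ⊢
    rwa [smul_sub] at this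
  refine le_antisymm (key t A) ?_
  have := key t⁻¹ (t • A)
  rwa [inv_smul_smul₀ ht] at this

namespace DualPair

variable {P D V W : Set E}

theorem exists_center (h : DualPair P D V W) (hpc : IsPerfectlyCentered P) {x : E} (hx : x ∈ P) :
    ∃ m ∈ P, act W m = act W x ∧ maximizers P m = actFace W x := by
  obtain ⟨m, hm, hmc⟩ := hpc _ (h.isNonemptyFace_actFace hx)
  have hmc : actFace W x = maximizers P m := hmc
  have hr := isRelInner_of_mem_intrinsicInterior hm
  have h1 : m ∈ P := by rw [h.left_eq]; exact hr.1.1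
  refine ⟨m, h1, ?_, hmc.symm⟩
  rw [hmc] at hr
  have := h.eq_actFace_of_isRelInner hr
  rw [← hmc, actFace_eq_iff (h.left_eq ▸ hx) (h.left_eq ▸ h1)] at this
  exact this.symm

/-- In a perfectly centered polytope, the maximizers in the direction of a point `x` lie in the
smallest face containing `x`. -/
theorem maximizers_self_subset (h : DualPair P D V W) (hpc : IsPerfectlyCentered P) {x : E}
    (hx : x ∈ P) : maximizers P x ⊆ actFace W x := by
  induction hn : (W \ act W x).ncard using Nat.strong_induction_on generalizing x with
  | _ n ih =>
    subst hn
    obtain ⟨m, hm, hact, hmax⟩ := h.exists_center hpc hx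
    by_cases hxm : x - m = 0
    · rw [sub_eq_zero] at hxm
      rw [← hmax, hxm]
    have hxW := hx
    rw [h.left_eq] at hxW
    have hu : ∀ w ∈ act W x, ⟪x - m, w⟫ = 0 := fun w hw => by
      rw [inner_sub_left, hw.2, (hact ▸ hw : w ∈ act W m).2, sub_self]
    obtain ⟨t, ht, hq, w, hw, hpos⟩ := exists_exit h.finW hxW hu (h.exists_inner_pos hxm)
    rw [← h.left_eq] at hq
    -- Push `x` away from the center `m` of its face until a new constraint becomes active. The
    -- induction on the number of inactive constraints then applies to `q`, and `(1 + t) • x = q + t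
    -- • m` with compatible maximizers of `q` and `m`.
    set q := x + t • (x - m) with hqdef
    have hsub : act W x ⊆ act W q := act_subset_act_add_smul hu t
    have hlt : (W \ act W q).ncard < (W \ act W x).ncard := by
      refine Set.ncard_lt_ncard ⟨Set.sdiff_subset_sdiff_right hsub, fun hss => ?_⟩
        (h.finW.subset Set.sdiff_subset)
      exact (hss ⟨hw.1, fun hwx => hpos.ne' (hu w hwx)⟩).2 hw
    have hqx : maximizers P q ⊆ maximizers P m := by
      rw [hmax]
      exact (ih _ hlt hq rfl).trans fun z hz => ⟨hz.1, hsub.trans hz.2⟩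
    obtain ⟨z, hz⟩ := maximizers_nonempty h.isCompact ⟨x, hx⟩ q
    have hsum : maximizers P (q + t • m) = maximizers P q ∩ maximizers P (t • m) :=
      maximizers_add_right ⟨z, hz, by rw [maximizers_smul _ _ ht]; exact hqx hz⟩
    have heq : q + t • m = (1 + t) • x := by rw [hqdef]; module
    rw [heq, maximizers_smul _ _ (by positivity), maximizers_smul _ _ ht] at hsum
    rw [hsum, ← hmax]
    exact Set.inter_subset_right

/-- Since `x` is relatively interior to its face, a dual point tight at `x` is tight on the whole
face. -/
theorem maximizers_right_eq_dualFace (h : DualPair P D V W) {x : E} (hx : x ∈ P)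
    (hne : (act W x).Nonempty) : maximizers D x = dualFace D (actFace W x) := by
  obtain ⟨w, hw⟩ := hne
  have hxW := hx
  rw [h.left_eq] at hxW
  rw [h.symm.maximizers_eq_tight hx (h.subset_right hw.1) (by rw [real_inner_comm]; exact hw.2)]
  ext y
  refine and_congr_right fun hy => ⟨fun h1 z hz => ?_, fun h1 => ?_⟩
  · refine (isRelInner_actFace h.finW hxW).inner_eq_one (fun z hz => ?_) ?_ hz
    · exact h.inner_le (by rw [h.left_eq]; exact hz.1) hy
    · rw [real_inner_comm]; exact h1
  · rw [real_inner_comm]; exact h1 x (self_mem_actFace hxW)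

theorem ne_zero_of_act_nonempty {W : Set E} {x : E} (h : (act W x).Nonempty) : x ≠ 0 := by
  rintro rfl
  obtain ⟨w, hw⟩ := h
  have := hw.2
  rw [inner_zero_left] at this
  exact zero_ne_one this

/-- The scaled center of a face is a relative interior point of the dual face. -/
theorem dualFace_eq_actFace (h : DualPair P D V W) {m : E} (hm : m ∈ P)
    (hne : (act W m).Nonempty) (hmax : maximizers P m = actFace W m) :
    ⟪m, m⟫⁻¹ • m ∈ D ∧ maximizers P m = {y ∈ P | ⟪y, ⟪m, m⟫⁻¹ • m⟫ = 1} ∧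
      dualFace D (actFace W m) = actFace V (⟪m, m⟫⁻¹ • m) := by
  have hn : 0 < ⟪m, m⟫ := real_inner_self_pos.2 (ne_zero_of_act_nonempty hne)
  have hmW := hm
  rw [h.left_eq] at hmW
  have hmm : m ∈ maximizers P m := by rw [hmax]; exact self_mem_actFace hmW
  have hD : ⟪m, m⟫⁻¹ • m ∈ D := by
    rw [h.right_eq_dual]
    intro y hy
    rw [real_inner_smul_left, inv_mul_le_one₀ hn, real_inner_comm]
    exact hmm.2 y hy
  have htight : maximizers P m = {y ∈ P | ⟪y, ⟪m, m⟫⁻¹ • m⟫ = 1} := by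
    rw [maximizers_eq_of_mem hmm]
    ext y
    simp only [Set.mem_ofPred_eq, inner_smul_right, inv_mul_eq_one₀ hn.ne']
    exact and_congr_right fun _ => eq_comm
  have hDV := hD
  rw [h.right_eq] at hDV
  refine ⟨hD, htight, Set.Subset.antisymm (fun y hy => ⟨h.right_eq ▸ hy.1, fun v hv => ?_⟩)
    fun y hy => ?_⟩
  · refine ⟨hv.1, ?_⟩
    rw [real_inner_comm]
    refine hy.2 v ?_
    rw [← hmax, htight]
    exact ⟨h.symm.subset_right hv.1, by rw [real_inner_comm]; exact hv.2⟩
  · have hyD : y ∈ D := by rw [h.right_eq]; exact hy.1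
    refine ⟨hyD, fun x hx => ?_⟩
    rw [← hmax, htight] at hx
    rw [real_inner_comm]
    refine (isRelInner_actFace h.finV hDV).inner_eq_one (fun z hz => ?_) ?_ hy
    · rw [real_inner_comm]
      exact h.inner_le hx.1 (by rw [h.right_eq]; exact hz.1)
    · rw [real_inner_comm]; exact hx.2

/-- The generators active at the scaled center are points of the face, so a direction orthogonal to
the face is orthogonal to all of them. -/
theorem vectorSpan_dualFace (h : DualPair P D V W) {m : E} (hm : m ∈ P)
    (hne : (act W m).Nonempty) (hmax : maximizers P m = actFace W m) :
    vectorSpan ℝ (dualFace D (actFace W m)) = (Submodule.span ℝ (actFace W m))ᗮ := by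
  obtain ⟨hD, htight, heq⟩ := h.dualFace_eq_actFace hm hne hmax
  have hDV := hD
  rw [h.right_eq] at hDV
  refine le_antisymm ?_ fun d hd => ?_
  · rw [vectorSpan_def, Submodule.span_le]
    rintro _ ⟨y, hy, z, hz, rfl⟩
    refine mem_orthogonal_span_iff.2 fun x hx => ?_
    simp only [vsub_eq_sub]
    rw [real_inner_comm, inner_sub_right, hy.2 x hx, hz.2 x hx, sub_self]
  · rw [heq, mem_vectorSpan_actFace_iff h.finV hDV]
    intro v hv
    refine mem_orthogonal_span_iff.1 hd v ?_
    rw [← hmax, htight]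
    exact ⟨h.symm.subset_right hv.1, by rw [real_inner_comm]; exact hv.2⟩

/-- A proper face lies in a hyperplane missing the origin, so its linear span has one dimension more
than the face; the dual face fills the orthogonal complement. -/
theorem dim_dualFace [FiniteDimensional ℝ E] (h : DualPair P D V W) {m : E} (hm : m ∈ P)
    (hne : (act W m).Nonempty) (hmax : maximizers P m = actFace W m) :
    dim (dualFace D (actFace W m)) + dim (actFace W m) + 1 = Module.finrank ℝ E := by
  have hmW := hm
  rw [h.left_eq] at hmW
  have hmF := self_mem_actFace hmW
  have hspan : Submodule.span ℝ (actFace W m) =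
      vectorSpan ℝ (actFace W m) ⊔ Submodule.span ℝ {m} := by
    refine le_antisymm (Submodule.span_le.2 fun x hx => ?_) (sup_le ?_ ?_)
    · have := Submodule.add_mem_sup (vsub_mem_vectorSpan ℝ hx hmF)
        (Submodule.mem_span_singleton_self (R := ℝ) m)
      rwa [vsub_eq_sub, sub_add_cancel] at this
    · rw [vectorSpan_def, Submodule.span_le]
      rintro _ ⟨y, hy, z, hz, rfl⟩
      exact Submodule.sub_mem _ (Submodule.subset_span hy) (Submodule.subset_span hz)
    · exact Submodule.span_mono (Set.singleton_subset_iff.2 hmF)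
  have hnot : m ∉ vectorSpan ℝ (actFace W m) := by
    intro hcon
    obtain ⟨w, hw⟩ := hne
    have := (mem_vectorSpan_actFace_iff h.finW hmW).1 hcon w hw
    rw [hw.2] at this
    exact one_ne_zero this
  have h1 := Submodule.finrank_sup_span_singleton hnot
  rw [← hspan] at h1
  have h2 := Submodule.finrank_add_finrank_orthogonal (Submodule.span ℝ (actFace W m))
  rw [dim_eq_finrank_vectorSpan, dim_eq_finrank_vectorSpan, h.vectorSpan_dualFace hm hne hmax]
  omega

end DualPair

/-! ### Faces of the Nesterov rounding -/

/-- `m` is the center of the proper face of `P` on which the constraints active at `m` are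
active. -/
structure IsCenter (P W : Set E) (m : E) : Prop where
  mem : m ∈ P
  act_nonempty : (act W m).Nonempty
  maximizers_eq : maximizers P m = actFace W m

theorem mem_maximizers_of_add_mem {P R : Set E} {c p r : E} (hp : p ∈ P) (hr : r ∈ R)
    (h : p + r ∈ maximizers (P + R) c) : p ∈ maximizers P c ∧ r ∈ maximizers R c := by
  refine ⟨⟨hp, fun y hy => ?_⟩, ⟨hr, fun y hy => ?_⟩⟩
  · have := h.2 _ (Set.add_mem_add hy hr)
    simp only [inner_add_left] at this
    linarith
  · have := h.2 _ (Set.add_mem_add hp hy)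
    simp only [inner_add_left] at this
    linarith

theorem maximizers_rounding {P : Set E} {a : ℝ} (ha : 0 < a) (c : E) :
    maximizers (rounding a P) c = maximizers P c + a • maximizers (dual P) c := by
  rw [rounding, maximizers_add_left, maximizers_smul_left ha]

/-- The summands of a face of the rounding are determined by the face. -/
theorem maximizers_subset_of_rounding {P : Set E} {a : ℝ} (ha : 0 < a) {c c' : E}
    (hP : (maximizers P c).Nonempty) (hD : (maximizers (dual P) c).Nonempty)
    (h : maximizers (rounding a P) c ⊆ maximizers (rounding a P) c') :
    maximizers P c ⊆ maximizers P c' ∧ maximizers (dual P) c ⊆ maximizers (dual P) c' := by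
  have key : ∀ p ∈ maximizers P c, ∀ r ∈ maximizers (dual P) c,
      p ∈ maximizers P c' ∧ r ∈ maximizers (dual P) c' := by
    intro p hp r hr
    have hm : p + a • r ∈ maximizers (rounding a P) c := by
      rw [maximizers_rounding ha]
      exact Set.add_mem_add hp (Set.smul_mem_smul_set hr)
    obtain ⟨h1, h2⟩ := mem_maximizers_of_add_mem hp.1 (Set.smul_mem_smul_set hr.1) (h hm)
    rw [maximizers_smul_left ha, Set.smul_mem_smul_set_iff₀ ha.ne'] at h2
    exact ⟨h1, h2⟩
  obtain ⟨p, hp⟩ := hP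
  obtain ⟨r, hr⟩ := hD
  exact ⟨fun x hx => (key x hx r hr).1, fun x hx => (key p hp x hx).2⟩

namespace DualPair

variable {P V W : Set E}

theorem actFace_zero {D : Set E} (h : DualPair P D V W) : actFace W 0 = P := by
  rw [h.left_eq]
  refine Set.Subset.antisymm (fun y hy => hy.1) fun y hy => ⟨hy, fun w hw => ?_⟩
  exact absurd hw.2 (by rw [inner_zero_left]; exact zero_ne_one)

/-- Nested proper faces `F ⊆ G` yield the face `F + a • G^D` of the rounding. -/
theorem maximizers_center_add (h : DualPair P (dual P) V W) {f g : E} (hf : IsCenter P W f)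
    (hg : IsCenter P W g) (hfg : act W g ⊆ act W f) {a : ℝ} (ha : 0 < a) :
    maximizers P (f + a • ⟪g, g⟫⁻¹ • g) = actFace W f ∧
      maximizers (dual P) (f + a • ⟪g, g⟫⁻¹ • g) = dualFace (dual P) (actFace W g) := by
  have hn : 0 < ⟪g, g⟫ := real_inner_self_pos.2 (ne_zero_of_act_nonempty hg.act_nonempty)
  have hfW := hf.mem
  rw [h.left_eq] at hfW
  have hsub : actFace W f ⊆ actFace W g := (actFace_subset_iff hfW).2 hfg
  have hs : 0 < a * ⟪g, g⟫⁻¹ := by positivity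
  rw [smul_smul]
  constructor
  · rw [maximizers_add_right, maximizers_smul _ _ hs, hf.maximizers_eq, hg.maximizers_eq,
      Set.inter_eq_left.2 hsub]
    rw [maximizers_smul _ _ hs, hf.maximizers_eq, hg.maximizers_eq, Set.inter_eq_left.2 hsub]
    exact ⟨f, self_mem_actFace hfW⟩
  · have h1 := h.maximizers_right_eq_dualFace hf.mem hf.act_nonempty
    have h2 := h.maximizers_right_eq_dualFace hg.mem hg.act_nonempty
    have hsub' : dualFace (dual P) (actFace W g) ⊆ dualFace (dual P) (actFace W f) :=
      fun y hy => ⟨hy.1, fun x hx => hy.2 x (hsub hx)⟩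
    rw [maximizers_add_right, maximizers_smul _ _ hs, h1, h2, Set.inter_eq_right.2 hsub']
    rw [maximizers_smul _ _ hs, h1, h2, Set.inter_eq_right.2 hsub', ← h2]
    exact maximizers_nonempty h.symm.isCompact ⟨0, h.symm.zero_mem⟩ _

/-- The vector is the one that exposes this face in `maximizers_center_add`; the coincidence is what
makes the rounding perfectly centered. -/
theorem isRelInner_center_add (h : DualPair P (dual P) V W) {f g : E} (hf : IsCenter P W f)
    (hg : IsCenter P W g) (a : ℝ) :
    IsRelInner (actFace W f + a • dualFace (dual P) (actFace W g)) (f + a • ⟪g, g⟫⁻¹ • g) := by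
  obtain ⟨hD, _, heq⟩ := h.dualFace_eq_actFace hg.mem hg.act_nonempty hg.maximizers_eq
  rw [h.right_eq] at hD
  refine IsRelInner.add ?_ ?_ (isRelInner_actFace h.finW (h.left_eq ▸ hf.mem)) ?_
  · rw [← hf.maximizers_eq]
    exact convex_maximizers h.convex _
  · rw [← h.maximizers_right_eq_dualFace hg.mem hg.act_nonempty]
    exact (convex_maximizers h.symm.convex _).smul a
  · rw [heq]
    exact (isRelInner_actFace h.finV hD).smul a

/-- Dimensions add: the directions of `F ⊆ G` lie in the span of `G`, those of the dual face in its
orthogonal complement. -/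
theorem dim_add_dualFace [FiniteDimensional ℝ E] (h : DualPair P (dual P) V W) {f g : E}
    (hf : IsCenter P W f) (hg : IsCenter P W g) (hfg : act W g ⊆ act W f) {a : ℝ} (ha : 0 < a) :
    dim (actFace W f + a • dualFace (dual P) (actFace W g)) + dim (actFace W g) + 1 =
      dim (actFace W f) + Module.finrank ℝ E := by
  obtain ⟨hD, _, heq⟩ := h.dualFace_eq_actFace hg.mem hg.act_nonempty hg.maximizers_eq
  rw [h.right_eq] at hD
  have hfW := hf.mem
  rw [h.left_eq] at hfW
  have hsub : actFace W f ⊆ actFace W g := (actFace_subset_iff hfW).2 hfg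
  have hne : (dualFace (dual P) (actFace W g)).Nonempty := by
    rw [heq]; exact ⟨_, self_mem_actFace hD⟩
  have hdim := h.dim_dualFace hg.mem hg.act_nonempty hg.maximizers_eq
  have hdisj : vectorSpan ℝ (actFace W f) ⊓
      vectorSpan ℝ (dualFace (dual P) (actFace W g)) = ⊥ := by
    rw [h.vectorSpan_dualFace hg.mem hg.act_nonempty hg.maximizers_eq, ← disjoint_iff]
    refine (Submodule.orthogonal_disjoint (Submodule.span ℝ (actFace W g))).mono_left ?_
    rw [vectorSpan_def, Submodule.span_le]
    rintro _ ⟨y, hy, z, hz, rfl⟩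
    exact Submodule.sub_mem _ (Submodule.subset_span (hsub hy)) (Submodule.subset_span (hsub hz))
  have hsum := Submodule.finrank_sup_add_finrank_inf_eq (vectorSpan ℝ (actFace W f))
    (vectorSpan ℝ (dualFace (dual P) (actFace W g)))
  rw [hdisj, finrank_bot, ← vectorSpan_smul_set (dualFace (dual P) (actFace W g)) ha.ne',
    ← vectorSpan_add_set ⟨f, self_mem_actFace hfW⟩ hne.smul_set, vectorSpan_smul_set _ ha.ne']
    at hsum
  simp only [dim_eq_finrank_vectorSpan] at hdim ⊢
  omega

/-- Every proper face of the rounding comes from nested proper faces. -/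
theorem exists_centers [FiniteDimensional ℝ E] (h : DualPair P (dual P) V W)
    (hpc : IsPerfectlyCentered P) {c : E} (hc : c ≠ 0) :
    ∃ f g, IsCenter P W f ∧ IsCenter P W g ∧ act W g ⊆ act W f ∧
      maximizers P c = actFace W f ∧
      maximizers (dual P) c = dualFace (dual P) (actFace W g) := by
  obtain ⟨t, ht, htD, htight⟩ := h.exists_tight hc
  obtain ⟨s, hs, hsP, hsight⟩ := h.symm.exists_tight hc
  obtain ⟨x₀, hx₀, hF⟩ := h.exists_eq_actFace
    ⟨maximizers_nonempty h.isCompact ⟨0, h.zero_mem⟩ c, c, rfl⟩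
  obtain ⟨f, hf, hfact, hfmax⟩ := h.exists_center hpc hx₀
  obtain ⟨g, hg, hgact, hgmax⟩ := h.exists_center hpc hsP
  have hx₀W := hx₀
  rw [h.left_eq] at hx₀W
  have hfW := hf
  rw [h.left_eq] at hfW
  have hgW := hg
  rw [h.left_eq] at hgW
  have hsW := hsP
  rw [h.left_eq] at hsW
  have hfne : (act W f).Nonempty := by
    rw [hfact, Set.nonempty_iff_ne_empty]
    intro hemp
    have h0 : (0 : E) ∈ maximizers P c := by
      rw [hF]
      exact ⟨h.left_eq ▸ h.zero_mem, by rw [hemp]; exact Set.empty_subset _⟩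
    rw [htight] at h0
    have := h0.2
    rw [inner_zero_left] at this
    exact zero_ne_one this
  -- Some point of the dual pairs to 1 with `s • c`; if all generators paired to less, so would
  -- their convex hull.
  have hsne : (act W (s • c)).Nonempty := by
    by_contra hemp
    have hlt : ∀ w ∈ W, ⟪s • c, w⟫ < 1 := fun w hw =>
      lt_of_le_of_ne (hsW w hw) fun h1 => hemp ⟨w, hw, h1⟩
    have hconv : Convex ℝ {y : E | ⟪s • c, y⟫ < 1} :=
      convex_halfSpace_lt (innerSL ℝ (s • c)).toLinearMap.isLinear 1
    have hsub := convexHull_min (s := W) (fun w hw => hlt w hw) hconv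
    rw [← h.right_hull] at hsub
    obtain ⟨y, hy⟩ := maximizers_nonempty h.symm.isCompact ⟨0, h.symm.zero_mem⟩ c
    rw [hsight] at hy
    have h1 : ⟪s • c, y⟫ < 1 := hsub hy.1
    rw [real_inner_comm] at h1
    exact h1.ne hy.2
  have hfF : actFace W x₀ = actFace W f := (actFace_eq_iff hx₀W hfW).2 hfact.symm
  have hgG : actFace W (s • c) = actFace W g := (actFace_eq_iff hsW hgW).2 hgact.symm
  refine ⟨f, g, ⟨hf, hfne, hfmax.trans hfF⟩, ⟨hg, hgact ▸ hsne, hgmax.trans hgG⟩, ?_,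
    hF.trans hfF, ?_⟩
  -- Nestedness is exactly `maximizers_self_subset` at the boundary point `s • c`.
  · have h1 := h.maximizers_self_subset hpc hsP
    rw [maximizers_smul _ _ hs, hF] at h1
    rw [hgact, hfact]
    exact (h1 (self_mem_actFace hx₀W)).2
  · rw [← hgG, ← h.maximizers_right_eq_dualFace hsP hsne, maximizers_smul _ _ hs]

theorem rounding_mem_nhds (h : DualPair P (dual P) V W) (a : ℝ) :
    rounding a P ∈ 𝓝 (0 : E) := by
  refine Filter.mem_of_superset h.mem_nhds fun x hx => ⟨x, hx, 0, ?_, add_zero x⟩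
  exact ⟨0, h.symm.zero_mem, smul_zero a⟩

theorem isPolytope_rounding (h : DualPair P (dual P) V W) (a : ℝ) :
    IsPolytope (rounding a P) := by
  refine ⟨V + a • W, h.finV.add (h.finW.image _), ?_⟩
  rw [convexHull_add, convexHull_smul, ← h.left_hull, ← h.right_hull, rounding]

theorem isPerfectlyCentered_rounding [FiniteDimensional ℝ E] (h : DualPair P (dual P) V W)
    (hpc : IsPerfectlyCentered P) {a : ℝ} (ha : 0 < a) : IsPerfectlyCentered (rounding a P) := by
  rintro _ ⟨hne, c, rfl⟩
  by_cases hc : c = 0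
  · rw [hc, maximizers_zero]
    refine ⟨0, interior_subset_intrinsicInterior
      (mem_interior_iff_mem_nhds.2 (h.rounding_mem_nhds a)), ?_⟩
    exact (maximizers_zero _).symm
  · obtain ⟨f, g, hf, hg, hfg, h1, h2⟩ := h.exists_centers hpc hc
    obtain ⟨h3, h4⟩ := h.maximizers_center_add hf hg hfg ha
    have hconv : Convex ℝ (maximizers (rounding a P) c) :=
      convex_maximizers (h.convex.add (h.symm.convex.smul a)) c
    have heq := maximizers_rounding (P := P) ha c
    rw [h1, h2] at heq
    refine ⟨f + a • ⟪g, g⟫⁻¹ • g, ?_, ?_⟩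
    · refine IsRelInner.mem_intrinsicInterior hconv ?_
      rw [heq]
      exact h.isRelInner_center_add hf hg a
    · show maximizers (rounding a P) c = _
      rw [heq, maximizers_rounding ha, h3, h4]

/-- Proper faces are the faces with a center. -/
theorem exists_isCenter_iff [FiniteDimensional ℝ E] {D : Set E} (h : DualPair P D V W)
    (hpc : IsPerfectlyCentered P) (F : Set E) :
    (IsNonemptyFace P F ∧ dim F < Module.finrank ℝ E) ↔ ∃ f, IsCenter P W f ∧ F = actFace W f := by
  constructor
  · rintro ⟨hF, hlt⟩
    obtain ⟨x, hx, rfl⟩ := h.exists_eq_actFace hF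
    obtain ⟨f, hf, hact, hmax⟩ := h.exists_center hpc hx
    have hF' : actFace W x = actFace W f :=
      (actFace_eq_iff (h.left_eq ▸ hx) (h.left_eq ▸ hf)).2 hact.symm
    refine ⟨f, ⟨hf, ?_, hmax.trans hF'⟩, hF'⟩
    rw [Set.nonempty_iff_ne_empty]
    intro hemp
    have hP : P ⊆ actFace W f := fun y hy =>
      ⟨h.left_eq ▸ hy, by rw [hemp]; exact Set.empty_subset _⟩
    rw [hF', dim_eq_finrank_of_mem_nhds (Filter.mem_of_superset h.mem_nhds hP)] at hlt
    exact hlt.false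
  · rintro ⟨f, hf, rfl⟩
    refine ⟨h.isNonemptyFace_actFace hf.mem, ?_⟩
    have h0 : act W (0 : E) = ∅ := Set.eq_empty_of_forall_notMem fun w hw =>
      ne_zero_of_act_nonempty ⟨w, hw⟩ rfl
    have := dim_actFace_lt h.finW (x := f) (y := 0) (h.left_eq ▸ hf.mem)
      (h.left_eq ▸ h.zero_mem) (by rw [h0]; exact Set.empty_ssubset.2 hf.act_nonempty)
    rwa [h.actFace_zero, dim_eq_finrank_of_mem_nhds h.mem_nhds] at this

/-- The faces of the rounding correspond to the pairs of nested proper faces. -/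
theorem bijOn_kFaces_rounding [FiniteDimensional ℝ E] (h : DualPair P (dual P) V W)
    (hpc : IsPerfectlyCentered P) {a : ℝ} (ha : 0 < a) {k : ℕ} (hk : k < Module.finrank ℝ E) :
    Set.BijOn (fun p : Set E × Set E => p.1 + a • dualFace (dual P) p.2)
      {p | (IsNonemptyFace P p.1 ∧ dim p.1 < Module.finrank ℝ E) ∧
        (IsNonemptyFace P p.2 ∧ dim p.2 < Module.finrank ℝ E) ∧ p.1 ⊆ p.2 ∧
        k + dim p.2 + 1 = dim p.1 + Module.finrank ℝ E}
      (kFaces k (rounding a P)) := by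
  simp only [h.exists_isCenter_iff hpc]
  refine ⟨?_, ?_, ?_⟩
  · rintro ⟨_, _⟩ ⟨⟨f, hf, rfl⟩, ⟨g, hg, rfl⟩, hsub, hdim⟩
    have hfg := (actFace_subset_iff (h.left_eq ▸ hf.mem)).1 hsub
    obtain ⟨h3, h4⟩ := h.maximizers_center_add hf hg hfg ha
    refine ⟨⟨⟨_, (h.isRelInner_center_add hf hg a).1⟩, f + a • ⟪g, g⟫⁻¹ • g, ?_⟩, ?_⟩
    · rw [maximizers_rounding ha, h3, h4]
    · have := h.dim_add_dualFace hf hg hfg ha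
      dsimp only at hdim ⊢
      omega
  · rintro ⟨_, _⟩ ⟨⟨f, hf, rfl⟩, ⟨g, hg, rfl⟩, hsub, -⟩ ⟨_, _⟩ ⟨⟨f', hf', rfl⟩, ⟨g', hg', rfl⟩, hsub', -⟩
      heq
    dsimp only at hsub hsub' heq
    obtain ⟨h1, h2⟩ := h.maximizers_center_add hf hg
      ((actFace_subset_iff (h.left_eq ▸ hf.mem)).1 hsub) ha
    obtain ⟨h3, h4⟩ := h.maximizers_center_add hf' hg'
      ((actFace_subset_iff (h.left_eq ▸ hf'.mem)).1 hsub') ha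
    rw [← h1, ← h2, ← h3, ← h4, ← maximizers_rounding ha, ← maximizers_rounding ha] at heq
    have hneP := fun c => maximizers_nonempty h.isCompact ⟨0, h.zero_mem⟩ c
    have hneD := fun c => maximizers_nonempty h.symm.isCompact ⟨0, h.symm.zero_mem⟩ c
    have s1 := maximizers_subset_of_rounding ha (hneP _) (hneD _) heq.subset
    have s2 := maximizers_subset_of_rounding ha (hneP _) (hneD _) heq.superset
    rw [h1, h2, h3, h4] at s1 s2
    -- The dual face determines the face: it contains the scaled center of `g`, and the points of
    -- `P` tight against that center form exactly the face of `g`.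
    have key : ∀ {g g' : E}, IsCenter P W g → IsCenter P W g' →
        dualFace (dual P) (actFace W g) ⊆ dualFace (dual P) (actFace W g') →
        actFace W g' ⊆ actFace W g := by
      intro g g' hg hg' hs x hx
      obtain ⟨hD, htight, hact⟩ := h.dualFace_eq_actFace hg.mem hg.act_nonempty hg.maximizers_eq
      have hm : ⟪g, g⟫⁻¹ • g ∈ dualFace (dual P) (actFace W g) := by
        rw [hact]
        exact self_mem_actFace (h.right_eq ▸ hD)
      rw [← hg.maximizers_eq, htight]
      exact ⟨by rw [h.left_eq]; exact hx.1, (hs hm).2 x hx⟩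
    exact Prod.ext (s1.1.antisymm s2.1) ((key hg' hg s2.2).antisymm (key hg hg' s1.2))
  · rintro _ ⟨⟨hne, c, rfl⟩, hdim⟩
    have hc : c ≠ 0 := by
      rintro rfl
      rw [maximizers_zero, dim_eq_finrank_of_mem_nhds (h.rounding_mem_nhds a)] at hdim
      omega
    obtain ⟨f, g, hf, hg, hfg, h1, h2⟩ := h.exists_centers hpc hc
    have heq := maximizers_rounding (P := P) ha c
    rw [h1, h2] at heq
    refine ⟨(actFace W f, actFace W g), ⟨⟨f, hf, rfl⟩, ⟨g, hg, rfl⟩,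
      (actFace_subset_iff (h.left_eq ▸ hf.mem)).2 hfg, ?_⟩, heq.symm⟩
    rw [heq] at hdim
    rw [← hdim]
    exact h.dim_add_dualFace hf hg hfg ha

end DualPair

/-! ### Counting faces in dimension three -/

section Counting

open Classical in
/-- Double counting of nested pairs and chains, given the diamond property. -/
theorem card_nested_pairs {X : Type*} [Preorder X] (A B C : Finset X)
    (hA : ∀ b ∈ B, (A.filter (· ≤ b)).card = 2) (hC : ∀ b ∈ B, (C.filter (b ≤ ·)).card = 2)
    (hB : ∀ a ∈ A, ∀ c ∈ C, a ≤ c → (B.filter fun b => a ≤ b ∧ b ≤ c).card = 2) :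
    ((A ×ˢ B).filter fun p => p.1 ≤ p.2).card = 2 * B.card ∧
      ((B ×ˢ C).filter fun p => p.1 ≤ p.2).card = 2 * B.card ∧
      ((A ×ˢ C).filter fun p => p.1 ≤ p.2).card = 2 * B.card := by
  simp only [Finset.card_filter] at hA hC hB ⊢
  simp only [Finset.sum_product]
  have h2 : ∑ b ∈ B, 2 = 2 * B.card := by rw [Finset.sum_const, smul_eq_mul, mul_comm]
  refine ⟨?_, ?_, ?_⟩
  · rw [Finset.sum_comm, ← h2]
    exact Finset.sum_congr rfl hA
  · rw [← h2]
    exact Finset.sum_congr rfl hC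
  · have h4 : ∑ a ∈ A, ∑ c ∈ C, ∑ b ∈ B, (if a ≤ b ∧ b ≤ c then 1 else 0) = 4 * B.card := by
      calc _ = ∑ b ∈ B, ∑ a ∈ A, ∑ c ∈ C, (if a ≤ b ∧ b ≤ c then 1 else 0) := by
            rw [Finset.sum_comm]
            refine (Finset.sum_congr rfl fun c _ => Finset.sum_comm).trans ?_
            rw [Finset.sum_comm]
            exact Finset.sum_congr rfl fun b _ => Finset.sum_comm
        _ = ∑ b ∈ B, (∑ a ∈ A, if a ≤ b then 1 else 0) * ∑ c ∈ C, if b ≤ c then 1 else 0 := by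
            refine Finset.sum_congr rfl fun b _ => ?_
            rw [Finset.sum_mul_sum]
            refine Finset.sum_congr rfl fun a _ => Finset.sum_congr rfl fun c _ => ?_
            by_cases h1 : a ≤ b <;> by_cases h2 : b ≤ c <;> simp [h1, h2]
        _ = ∑ b ∈ B, 4 := Finset.sum_congr rfl fun b hb => by rw [hA b hb, hC b hb]
        _ = _ := by rw [Finset.sum_const, smul_eq_mul, mul_comm]
    have h5 : ∑ a ∈ A, ∑ c ∈ C, ∑ b ∈ B, (if a ≤ b ∧ b ≤ c then 1 else 0) =
        2 * ∑ a ∈ A, ∑ c ∈ C, if a ≤ c then 1 else 0 := by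
      rw [Finset.mul_sum]
      refine Finset.sum_congr rfl fun a ha => ?_
      rw [Finset.mul_sum]
      refine Finset.sum_congr rfl fun c hc => ?_
      by_cases hac : a ≤ c
      · rw [hB a ha c hc hac, if_pos hac, mul_one]
      · rw [if_neg hac, mul_zero]
        exact Finset.sum_eq_zero fun b _ => if_neg fun hb => hac (hb.1.trans hb.2)
    omega

end Counting

/-! ### Incidences of vertices, edges and facets. -/

namespace DualPair

variable {P D V W : Set E}

theorem actFace_ssubset_iff {W : Set E} {x y : E} (hx : x ∈ halfspaces W)
    (hy : y ∈ halfspaces W) : actFace W x ⊂ actFace W y ↔ act W y ⊂ act W x := by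
  rw [ssubset_iff_subset_not_subset, ssubset_iff_subset_not_subset, actFace_subset_iff hx,
    actFace_subset_iff hy]

theorem dim_lt_of_ssubset [FiniteDimensional ℝ E] (h : DualPair P D V W) {F G : Set E}
    (hF : IsNonemptyFace P F) (hG : IsNonemptyFace P G) (hFG : F ⊂ G) : dim F < dim G := by
  obtain ⟨x, hx, rfl⟩ := h.exists_eq_actFace hF
  obtain ⟨y, hy, rfl⟩ := h.exists_eq_actFace hG
  rw [h.left_eq] at hx hy
  exact dim_actFace_lt h.finW hx hy ((actFace_ssubset_iff hx hy).1 hFG)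

theorem ncard_between [FiniteDimensional ℝ E] (h : DualPair P D V W) {F G : Set E}
    (hF : IsNonemptyFace P F) (hG : IsNonemptyFace P G) (hFG : F ⊆ G)
    (hdim : dim G = dim F + 2) : {H | IsNonemptyFace P H ∧ F ⊂ H ∧ H ⊂ G}.ncard = 2 := by
  obtain ⟨f, hf, rfl⟩ := h.exists_eq_actFace hF
  obtain ⟨g, hg, rfl⟩ := h.exists_eq_actFace hG
  rw [h.left_eq] at hf hg
  obtain ⟨z₁, hz₁, z₂, hz₂, hne, ⟨h1, h2⟩, ⟨h3, h4⟩, hall⟩ :=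
    exists_diamond h.finW hf hg ((actFace_subset_iff hf).1 hFG) hdim
  rw [Set.ncard_eq_two]
  refine ⟨actFace W z₁, actFace W z₂, fun heq => hne ((actFace_eq_iff hz₁ hz₂).1 heq), ?_⟩
  ext H
  constructor
  · rintro ⟨hH, hFH, hHG⟩
    obtain ⟨z, hz, rfl⟩ := h.exists_eq_actFace hH
    rw [h.left_eq] at hz
    rcases hall z hz ((actFace_ssubset_iff hz hg).1 hHG) ((actFace_ssubset_iff hf hz).1 hFH) with
      heq | heq
    · exact Or.inl ((actFace_eq_iff hz hz₁).2 heq)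
    · exact Or.inr ((actFace_eq_iff hz hz₂).2 heq)
  · rintro (rfl | rfl)
    · exact ⟨h.isNonemptyFace_actFace (h.left_eq ▸ hz₁), (actFace_ssubset_iff hf hz₁).2 h2,
        (actFace_ssubset_iff hz₁ hg).2 h1⟩
    · exact ⟨h.isNonemptyFace_actFace (h.left_eq ▸ hz₂), (actFace_ssubset_iff hf hz₂).2 h4,
        (actFace_ssubset_iff hz₂ hg).2 h3⟩

theorem ncard_below [FiniteDimensional ℝ E] (h : DualPair P D V W) {G : Set E}
    (hG : IsNonemptyFace P G) (hdim : dim G = 1) : {H | IsNonemptyFace P H ∧ H ⊂ G}.ncard = 2 := by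
  obtain ⟨g, hg, rfl⟩ := h.exists_eq_actFace hG
  rw [h.left_eq] at hg
  obtain ⟨z₁, hz₁, z₂, hz₂, hne, h1, h2, hall⟩ := h.exists_two_endpoints hg hdim
  rw [Set.ncard_eq_two]
  refine ⟨actFace W z₁, actFace W z₂, fun heq => hne ((actFace_eq_iff hz₁ hz₂).1 heq), ?_⟩
  ext H
  constructor
  · rintro ⟨hH, hHG⟩
    obtain ⟨z, hz, rfl⟩ := h.exists_eq_actFace hH
    rw [h.left_eq] at hz
    rcases hall z hz ((actFace_ssubset_iff hz hg).1 hHG) with heq | heq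
    · exact Or.inl ((actFace_eq_iff hz hz₁).2 heq)
    · exact Or.inr ((actFace_eq_iff hz hz₂).2 heq)
  · rintro (rfl | rfl)
    · exact ⟨h.isNonemptyFace_actFace (h.left_eq ▸ hz₁), (actFace_ssubset_iff hz₁ hg).2 h1⟩
    · exact ⟨h.isNonemptyFace_actFace (h.left_eq ▸ hz₂), (actFace_ssubset_iff hz₂ hg).2 h2⟩

theorem isNonemptyFace_self (h : DualPair P D V W) : IsNonemptyFace P P :=
  ⟨⟨0, h.zero_mem⟩, 0, (maximizers_zero P).symm⟩

theorem ssubset_of_subset_of_dim_lt {F G : Set E} (h : F ⊆ G) (hdim : dim F < dim G) : F ⊂ G :=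
  Set.ssubset_iff_subset_ne.2 ⟨h, fun heq => hdim.ne (congrArg dim heq)⟩

/-- An edge has two vertices. -/
theorem ncard_vertices_edge [FiniteDimensional ℝ E] (h : DualPair P D V W) {e : Set E}
    (he : e ∈ kFaces 1 P) : {v ∈ kFaces 0 P | v ⊆ e}.ncard = 2 := by
  refine Eq.trans ?_ (h.ncard_below he.1 he.2)
  congr 1
  ext v
  constructor
  · rintro ⟨⟨hv, hd⟩, hve⟩
    exact ⟨hv, ssubset_of_subset_of_dim_lt hve (by rw [hd, he.2]; norm_num)⟩
  · rintro ⟨hv, hve⟩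
    have := h.dim_lt_of_ssubset hv he.1 hve
    rw [he.2] at this
    exact ⟨⟨hv, by omega⟩, hve.subset⟩

/-- An edge of a three-dimensional polytope is in two facets. -/
theorem ncard_facets_edge [FiniteDimensional ℝ E] (h : DualPair P D V W)
    (h3 : Module.finrank ℝ E = 3) {e : Set E} (he : e ∈ kFaces 1 P) :
    {f ∈ kFaces 2 P | e ⊆ f}.ncard = 2 := by
  have hP : dim P = 3 := by rw [dim_eq_finrank_of_mem_nhds h.mem_nhds, h3]
  have hsub : ∀ F, IsNonemptyFace P F → F ⊆ P := by
    rintro _ ⟨-, c, rfl⟩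
    exact maximizers_subset P c
  refine Eq.trans ?_ (h.ncard_between he.1 h.isNonemptyFace_self (hsub e he.1) (by rw [hP, he.2]))
  congr 1
  ext f
  constructor
  · rintro ⟨⟨hf, hd⟩, hef⟩
    exact ⟨hf, ssubset_of_subset_of_dim_lt hef (by rw [hd, he.2]; norm_num),
      ssubset_of_subset_of_dim_lt (hsub f hf) (by rw [hd, hP]; norm_num)⟩
  · rintro ⟨hf, hef, hfP⟩
    have h1 := h.dim_lt_of_ssubset he.1 hf hef
    have h2 := h.dim_lt_of_ssubset hf h.isNonemptyFace_self hfP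
    rw [he.2] at h1
    rw [hP] at h2
    exact ⟨⟨hf, by omega⟩, hef.subset⟩

/-- Between a vertex and a two-dimensional face containing it there are two edges. -/
theorem ncard_edges_between [FiniteDimensional ℝ E] (h : DualPair P D V W) {v f : Set E}
    (hv : v ∈ kFaces 0 P) (hf : f ∈ kFaces 2 P) (hvf : v ⊆ f) :
    {e ∈ kFaces 1 P | v ⊆ e ∧ e ⊆ f}.ncard = 2 := by
  refine Eq.trans ?_ (h.ncard_between hv.1 hf.1 hvf (by rw [hv.2, hf.2]))
  congr 1
  ext e
  constructor
  · rintro ⟨⟨he, hd⟩, hve, hef⟩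
    exact ⟨he, ssubset_of_subset_of_dim_lt hve (by rw [hd, hv.2]; norm_num),
      ssubset_of_subset_of_dim_lt hef (by rw [hd, hf.2]; norm_num)⟩
  · rintro ⟨he, hve, hef⟩
    have h1 := h.dim_lt_of_ssubset hv.1 he hve
    have h2 := h.dim_lt_of_ssubset he hf.1 hef
    rw [hv.2] at h1
    rw [hf.2] at h2
    exact ⟨⟨he, by omega⟩, hve.subset, hef.subset⟩

/-- The pairs of nested faces of dimensions `i` and `j`. -/
def nestedPairs (i j : ℕ) (P : Set E) : Set (Set E × Set E) :=
  {p | p.1 ∈ kFaces i P ∧ p.2 ∈ kFaces j P ∧ p.1 ⊆ p.2}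

theorem ncard_nestedPairs [FiniteDimensional ℝ E] (h : DualPair P D V W)
    (h3 : Module.finrank ℝ E = 3) :
    (nestedPairs 0 1 P).ncard = 2 * faceNumber 1 P ∧
      (nestedPairs 1 2 P).ncard = 2 * faceNumber 1 P ∧
      (nestedPairs 0 2 P).ncard = 2 * faceNumber 1 P := by
  classical
  have hpoly : IsPolytope P := ⟨V, h.finV, h.left_hull⟩
  have hfin := hpoly.finite_kFaces
  have hmem : ∀ k F, F ∈ (hfin k).toFinset ↔ F ∈ kFaces k P := fun k F => (hfin k).mem_toFinset
  have hpairs : ∀ i j, (nestedPairs i j P).ncard =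
      (((hfin i).toFinset ×ˢ (hfin j).toFinset).filter fun p => p.1 ≤ p.2).card := by
    intro i j
    rw [← Set.ncard_coe_finset]
    congr 1
    ext p
    simp [nestedPairs, and_assoc]
  have hB : faceNumber 1 P = (hfin 1).toFinset.card := Set.ncard_eq_toFinset_card _ _
  rw [hpairs, hpairs, hpairs, hB]
  refine card_nested_pairs _ _ _ (fun e he => ?_) (fun e he => ?_) fun v hv f hf hvf => ?_
  · refine Eq.trans ?_ (h.ncard_vertices_edge ((hmem _ _).1 he))
    rw [← Set.ncard_coe_finset]
    congr 1
    ext v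
    simp
  · refine Eq.trans ?_ (h.ncard_facets_edge h3 ((hmem _ _).1 he))
    rw [← Set.ncard_coe_finset]
    congr 1
    ext v
    simp
  · refine Eq.trans ?_ (h.ncard_edges_between ((hmem _ _).1 hv) ((hmem _ _).1 hf) hvf)
    rw [← Set.ncard_coe_finset]
    congr 1
    ext v
    simp

/-- The face numbers of the Nesterov rounding of a three-dimensional perfectly centered
polytope. -/
theorem faceNumber_rounding [FiniteDimensional ℝ E] (h : DualPair P (dual P) V W)
    (hpc : IsPerfectlyCentered P) (h3 : Module.finrank ℝ E = 3) {a : ℝ} (ha : 0 < a) :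
    faceNumber 0 (rounding a P) = 2 * faceNumber 1 P ∧
      faceNumber 1 (rounding a P) = 4 * faceNumber 1 P ∧
      faceNumber 2 (rounding a P) = faceNumber 0 P + faceNumber 1 P + faceNumber 2 P := by
  have hpoly : IsPolytope P := ⟨V, h.finV, h.left_hull⟩
  have hfin := hpoly.finite_kFaces
  obtain ⟨h01, h12, h02⟩ := h.ncard_nestedPairs h3
  have hbij := fun k (hk : k < 3) =>
    (h.bijOn_kFaces_rounding hpc ha (k := k) (by rwa [h3])).ncard_eq.symm
  have hpfin : ∀ i j, (nestedPairs i j P).Finite := fun i j =>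
    ((hfin i).prod (hfin j)).subset fun p hp => ⟨hp.1, hp.2.1⟩
  rw [h3] at hbij
  refine ⟨?_, ?_, ?_⟩
  -- The relation `k + dim G + 1 = dim F + 3` leaves only dimensions `(0, 2)` for `k = 0`, `(0, 1)`
  -- and `(1, 2)` for `k = 1`, and equal dimensions, hence `F = G`, for `k = 2`.
  · refine Eq.trans ?_ h02
    rw [faceNumber, hbij 0 (by norm_num)]
    congr 1
    ext p
    constructor
    · rintro ⟨⟨hF, hFd⟩, ⟨hG, hGd⟩, hsub, hd⟩
      exact ⟨⟨hF, by omega⟩, ⟨hG, by omega⟩, hsub⟩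
    · rintro ⟨⟨hF, hFd⟩, ⟨hG, hGd⟩, hsub⟩
      exact ⟨⟨hF, by omega⟩, ⟨hG, by omega⟩, hsub, by omega⟩
  · have hdisj : Disjoint (nestedPairs 0 1 P) (nestedPairs 1 2 P) :=
      Set.disjoint_left.2 fun p hp hp' => by
        have h1 := hp.1.2
        have h2 := hp'.1.2
        omega
    have hunion := Set.ncard_union_eq hdisj (hpfin _ _) (hpfin _ _)
    rw [faceNumber, hbij 1 (by norm_num)]
    rw [show 4 * faceNumber 1 P = 2 * faceNumber 1 P + 2 * faceNumber 1 P by ring]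
    nth_rw 1 [← h01]
    rw [← h12, ← hunion]
    congr 1
    ext p
    constructor
    · rintro ⟨⟨hF, hFd⟩, ⟨hG, hGd⟩, hsub, hd⟩
      have : dim p.1 = 0 ∨ dim p.1 = 1 := by omega
      rcases this with h0 | h1
      · exact Or.inl ⟨⟨hF, h0⟩, ⟨hG, by omega⟩, hsub⟩
      · exact Or.inr ⟨⟨hF, h1⟩, ⟨hG, by omega⟩, hsub⟩
    · rintro (⟨⟨hF, hFd⟩, ⟨hG, hGd⟩, hsub⟩ | ⟨⟨hF, hFd⟩, ⟨hG, hGd⟩, hsub⟩) <;>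
      exact ⟨⟨hF, by omega⟩, ⟨hG, by omega⟩, hsub, by omega⟩
  · have hd01 : Disjoint (kFaces 0 P) (kFaces 1 P) := Set.disjoint_left.2 fun F hF hF' => by
      have h1 := hF.2
      have h2 := hF'.2
      omega
    have hd2 : Disjoint (kFaces 0 P ∪ kFaces 1 P) (kFaces 2 P) :=
      Set.disjoint_left.2 fun F hF hF' => by
        have h2 := hF'.2
        rcases hF with hF | hF <;> have h1 := hF.2 <;> omega
    rw [faceNumber, faceNumber, faceNumber, faceNumber, hbij 2 (by norm_num),
      ← Set.ncard_union_eq hd01 (hfin 0) (hfin 1),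
      ← Set.ncard_union_eq hd2 ((hfin 0).union (hfin 1)) (hfin 2),
      ← Set.ncard_image_of_injective (f := fun F : Set E => (F, F)) _
        (fun F G hFG => congrArg Prod.fst hFG)]
    congr 1
    ext ⟨F, G⟩
    constructor
    · rintro ⟨⟨hF, hFd⟩, ⟨hG, hGd⟩, hsub, hd⟩
      dsimp only at *
      have heq : F = G := by
        by_contra hne
        have := h.dim_lt_of_ssubset hF hG (Set.ssubset_iff_subset_ne.2 ⟨hsub, hne⟩)
        omega
      refine ⟨F, ?_, by rw [heq]⟩
      have : dim F = 0 ∨ dim F = 1 ∨ dim F = 2 := by omega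
      rcases this with h0 | h1 | h2
      · exact Or.inl (Or.inl ⟨hF, h0⟩)
      · exact Or.inl (Or.inr ⟨hF, h1⟩)
      · exact Or.inr ⟨hF, h2⟩
    · rintro ⟨H, hH, hHF⟩
      obtain ⟨rfl, rfl⟩ := Prod.mk.inj hHF
      have key : IsNonemptyFace P H ∧ dim H < 3 := by
        rcases hH with (hH | hH) | hH <;> exact ⟨hH.1, by rw [hH.2]; norm_num⟩
      exact ⟨key, key, subset_rfl, by dsimp only; omega⟩

end DualPair

/-! ### Iterated roundings -/

/-- A point with the most active constraints is a vertex: any direction in its face would lead to a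
further active constraint. Positivity keeps the ratio of face numbers away from division by zero. -/
theorem DualPair.faceNumber_zero_pos [FiniteDimensional ℝ E] {P D V W : Set E}
    (h : DualPair P D V W) : 0 < faceNumber 0 P := by
  have hpoly : IsPolytope P := ⟨V, h.finV, h.left_hull⟩
  have hfin : (act W '' P).Finite := h.finW.finite_subsets.subset (by
    rintro _ ⟨x, _, rfl⟩
    exact fun w hw => hw.1)
  obtain ⟨_, ⟨x, hx, rfl⟩, hmax⟩ := Set.exists_max_image _ Set.ncard hfin ⟨_, 0, h.zero_mem, rfl⟩
  have hxW := hx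
  rw [h.left_eq] at hxW
  rw [faceNumber, Set.ncard_pos (hpoly.finite_kFaces 0)]
  refine ⟨_, h.isNonemptyFace_actFace hx, ?_⟩
  rw [dim_eq_finrank_vectorSpan, Submodule.finrank_eq_zero, Submodule.eq_bot_iff]
  intro u hu
  by_contra hu0
  have hu' := (mem_vectorSpan_actFace_iff h.finW hxW).1 hu
  obtain ⟨t, ht, hq, w, hw, hpos⟩ := exists_exit h.finW hxW hu' (h.exists_inner_pos hu0)
  have hlt : (act W x).ncard < (act W (x + t • u)).ncard :=
    Set.ncard_lt_ncard ⟨act_subset_act_add_smul hu' t, fun hss => hpos.ne' (hu' w (hss hw))⟩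
      (h.finW.subset fun w hw => hw.1)
  exact (hmax _ ⟨_, h.left_eq ▸ hq, rfl⟩).not_gt hlt

theorem exists_dualPair_of_isPerfectlyCentered [FiniteDimensional ℝ E] {P : Set E}
    (hP : IsPolytope P) (hdim : dim P = Module.finrank ℝ E) (h0 : 0 < Module.finrank ℝ E)
    (hpc : IsPerfectlyCentered P) : ∃ V W, DualPair P (dual P) V W := by
  refine exists_dualPair hP (mem_nhds_zero_of_isPerfectlyCentered ?_ hdim hpc)
  rw [Set.nonempty_iff_ne_empty]
  rintro rfl
  rw [dim_eq_finrank_vectorSpan, vectorSpan_empty, finrank_bot] at hdim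
  omega

theorem iterRounding_invariant [FiniteDimensional ℝ E] {P : Set E} (hP : IsPolytope P)
    (hdim : dim P = Module.finrank ℝ E) (h0 : 0 < Module.finrank ℝ E)
    (hpc : IsPerfectlyCentered P) {α : ℕ → ℝ} (hα : ∀ i, 0 < α i) (n : ℕ) :
    IsPolytope (iterRounding α P n) ∧ dim (iterRounding α P n) = Module.finrank ℝ E ∧
      IsPerfectlyCentered (iterRounding α P n) := by
  induction n with
  | zero => exact ⟨hP, hdim, hpc⟩
  | succ n ih =>
    obtain ⟨h1, h2, h3⟩ := ih
    obtain ⟨V, W, h⟩ := exists_dualPair_of_isPerfectlyCentered h1 h2 h0 h3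
    exact ⟨h.isPolytope_rounding _, dim_eq_finrank_of_mem_nhds (h.rounding_mem_nhds _),
      h.isPerfectlyCentered_rounding h3 (hα n)⟩

theorem tendsto_faceNumber_ratio {a b : ℕ} (ha : 0 < a) :
    Tendsto (fun n : ℕ => ((b + (4 ^ n - 1) * a : ℕ) : ℝ) / ((4 ^ n * a : ℕ) : ℝ)) atTop (𝓝 1) := by
  have ha' : (a : ℝ) ≠ 0 := by positivity
  have heq : ∀ n : ℕ, ((b + (4 ^ n - 1) * a : ℕ) : ℝ) / ((4 ^ n * a : ℕ) : ℝ) =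
      1 + (((b : ℝ) - a) / a) * (1 / 4) ^ n := by
    intro n
    rw [Nat.cast_add, Nat.cast_mul, Nat.cast_sub (Nat.one_le_pow n 4 (by norm_num))]
    push_cast
    rw [one_div, inv_pow]
    field_simp
    ring
  simp only [heq]
  have := ((tendsto_pow_atTop_nhds_zero_of_lt_one (r := (1 / 4 : ℝ)) (by norm_num)
    (by norm_num)).const_mul (((b : ℝ) - a) / a)).const_add 1
  rwa [mul_zero, add_zero] at this

end NesterovRounding

theorem mainTheorem8 (P : Set (EuclideanSpace ℝ (Fin 3)))
    (hP : NesterovRounding.IsPolytope P) (hdim : NesterovRounding.dim P = 3)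
    (hpc : NesterovRounding.IsPerfectlyCentered P)
    (α : ℕ → ℝ) (hα : ∀ i, 0 < α i) :
    (∀ n : ℕ,
      NesterovRounding.IsPolytope (NesterovRounding.iterRounding α P n) ∧
      NesterovRounding.dim (NesterovRounding.iterRounding α P n) = 3 ∧
      NesterovRounding.IsPerfectlyCentered (NesterovRounding.iterRounding α P n)) ∧
    (∀ n : ℕ, 1 ≤ n →
      NesterovRounding.faceNumber 0 (NesterovRounding.iterRounding α P n) =
        4 ^ (n - 1) * NesterovRounding.faceNumber 0 (NesterovRounding.iterRounding α P 1) ∧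
      NesterovRounding.faceNumber 1 (NesterovRounding.iterRounding α P n) =
        2 * 4 ^ (n - 1) * NesterovRounding.faceNumber 0 (NesterovRounding.iterRounding α P 1) ∧
      NesterovRounding.faceNumber 2 (NesterovRounding.iterRounding α P n) =
        NesterovRounding.faceNumber 2 (NesterovRounding.iterRounding α P 1) +
          (4 ^ (n - 1) - 1) *
            NesterovRounding.faceNumber 0 (NesterovRounding.iterRounding α P 1)) ∧
    Tendsto (fun n : ℕ =>
      (NesterovRounding.faceNumber 2 (NesterovRounding.iterRounding α P n) : ℝ) /
        (NesterovRounding.faceNumber 0 (NesterovRounding.iterRounding α P n) : ℝ))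
      atTop (𝓝 1) := by
  have h3 : Module.finrank ℝ (EuclideanSpace ℝ (Fin 3)) = 3 := finrank_euclideanSpace_fin
  have hinv := NesterovRounding.iterRounding_invariant hP (hdim.trans h3.symm)
    (by rw [h3]; norm_num) hpc hα
  have hpair : ∀ n, ∃ V W, NesterovRounding.DualPair (NesterovRounding.iterRounding α P n)
      (NesterovRounding.dual (NesterovRounding.iterRounding α P n)) V W := fun n =>
    NesterovRounding.exists_dualPair_of_isPerfectlyCentered (hinv n).1 (hinv n).2.1
      (by rw [h3]; norm_num) (hinv n).2.2
  have hstep : ∀ n, _ := fun n =>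
    (hpair n).choose_spec.choose_spec.faceNumber_rounding (hinv n).2.2 h3 (hα n)
  have hcount : ∀ n : ℕ,
      NesterovRounding.faceNumber 0 (NesterovRounding.iterRounding α P (n + 1)) =
        4 ^ n * NesterovRounding.faceNumber 0 (NesterovRounding.iterRounding α P 1) ∧
      NesterovRounding.faceNumber 1 (NesterovRounding.iterRounding α P (n + 1)) =
        2 * 4 ^ n * NesterovRounding.faceNumber 0 (NesterovRounding.iterRounding α P 1) ∧
      NesterovRounding.faceNumber 2 (NesterovRounding.iterRounding α P (n + 1)) =
        NesterovRounding.faceNumber 2 (NesterovRounding.iterRounding α P 1) +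
          (4 ^ n - 1) * NesterovRounding.faceNumber 0 (NesterovRounding.iterRounding α P 1) := by
    intro n
    induction n with
    | zero =>
      -- Only the edge formula has content here: `4 f₁ = 2 * (2 f₁)` with the edges of `P`.
      obtain ⟨e0, e1, -⟩ := hstep 0
      refine ⟨by simp, ?_, by simp⟩
      change NesterovRounding.faceNumber 1 (NesterovRounding.rounding _ _) =
        2 * 4 ^ 0 * NesterovRounding.faceNumber 0 (NesterovRounding.rounding _ _)
      rw [e0, e1]
      ring
    | succ n ih =>
      obtain ⟨i0, i1, i2⟩ := ih
      obtain ⟨e0, e1, e2⟩ := hstep (n + 1)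
      rw [i1] at e0 e1
      rw [i0, i1, i2] at e2
      refine ⟨e0.trans (by ring), e1.trans (by ring), e2.trans ?_⟩
      -- Removes the truncated subtraction; what remains is `4 ^ n + 2 * 4 ^ n + (4 ^ n - 1) = 4 ^
      -- (n + 1) - 1` as the coefficient of the vertex number.
      obtain ⟨k, hk⟩ : ∃ k, 4 ^ n = k + 1 := ⟨4 ^ n - 1, by
        have : 0 < 4 ^ n := by positivity
        omega⟩
      have h4 : 4 ^ (n + 1) - 1 = 4 * k + 3 := by rw [pow_succ, hk]; omega
      rw [h4, hk, Nat.add_sub_cancel]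
      ring
  refine ⟨fun n => ⟨(hinv n).1, (hinv n).2.1.trans h3, (hinv n).2.2⟩, fun n hn => ?_, ?_⟩
  · obtain ⟨m, rfl⟩ := Nat.exists_eq_add_of_le' hn
    exact hcount m
  · obtain ⟨V, W, h1⟩ := hpair 1
    -- The closed forms hold from the first rounding on, so the sequence is shifted by one.
    rw [← tendsto_add_atTop_iff_nat 1]
    have := NesterovRounding.tendsto_faceNumber_ratio
      (b := NesterovRounding.faceNumber 2 (NesterovRounding.iterRounding α P 1))
      h1.faceNumber_zero_pos
    refine this.congr fun n => ?_
    rw [(hcount n).1, (hcount n).2.2]
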